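/- **Notation.** Let $N$ be a positive integer, let $a$ be a real number with $a>\max\{0,2-N\}$, and put $\lambda_a=\frac{N-2}{a}>-1$. For $\nu,t\in\mathbb R$ let $\check C^{\nu}_m(t)$ be the normalized Gegenbauer polynomials, defined by $$\frac{1-x^2}{(1-2tx+x^2)^{\nu+1}}=\sum_{m=0}^\infty \check C_m^\nu(t)\,x^m ,$$ let $\tilde I_\nu(w)=\sum_{k=0}^\infty\frac{(w/2)^{2k}}{k!\,\Gamma(\nu+k+1)}$ be the normalized $I$-Bessel function, and put $$\mathscr I(b,\nu,w,t)=\Gamma(b\nu+1)\sum_{m=0}^\infty\Big(\frac w2\Big)^{bm}\tilde I_{b(m+\nu)}(w)\,\check C_m^\nu(t)$$ for $b>0$, $b\nu>-1$, $w\in\mathbb C$ and $t\in[-1,1]$ (principal branch of the power). For $r,s\ge 0$ and $\omega,\mu\in S^{N-1}$ the kernel of the $a$-generalized Fourier transform is $$B_a(r\omega,s\mu)=\mathscr I\Big(\frac2a,\frac{N-2}2,\frac{2(rs)^{a/2}}{a\,i},\langle\omega,\mu\rangle\Big).$$ With $c_a=\Big(\int_{\mathbb R^N}e^{-|x|^a/a}|x|^{a-2}\,dx\Big)^{-1}$,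 the $a$-deformed heat kernel is, for $x,y\in\mathbb R^N$ and $t>0$, $$h_a(x,y;t)=c_a\int_{\mathbb R^N}\overline{B_a(x,\xi)}\,B_a(y,\xi)\,e^{-\frac ta|\xi|^a}\,|\xi|^{a-2}\,d\xi .$$ **Theorem (Expansion formula).** Let $r,s\ge 0$, $t>0$ and $\omega,\mu\in S^{N-1}$. Then the series defining $\mathscr I\big(\frac2a,\frac{N-2}2,w,\langle\omega,\mu\rangle\big)$ converges absolutely for every $w\in\mathbb C$, the integral defining $h_a(r\omega,s\mu;t)$ converges absolutely, and $$h_a(r\omega,s\mu;t)=t^{-(\lambda_a+1)}\,e^{-\frac{r^a+s^a}{at}}\;\mathscr I\Big(\frac2a,\frac{N-2}2,\frac{2(rs)^{a/2}}{at},\langle\omega,\mu\rangle\Big).$$ -/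

import Mathlib

open Complex MeasureTheory
open scoped ComplexConjugate Nat

noncomputable section

/-- The normalized Gegenbauer polynomial `Č_m^ν(t)`: the coefficient of `x ^ m` in the expansion of
`(1 - x²) / (1 - 2tx + x²) ^ (ν + 1)` in powers of `x`. (The generating function is analytic near
`x = 0`, so its formal expansion is its Taylor expansion there.) -/
def normGegenbauer (ν : ℝ) (m : ℕ) (t : ℝ) : ℝ :=
  iteratedDeriv m (fun x : ℝ => (1 - x ^ 2) / (1 - 2 * t * x + x ^ 2) ^ (ν + 1)) 0 / (m ! : ℝ)

/-- The normalized I-Bessel function `Ĩ_ν(w) = ∑ₖ (w/2)^(2k) / (k! Γ(ν + k + 1))`. -/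
def normBesselI (ν : ℝ) (w : ℂ) : ℂ :=
  ∑' k : ℕ, (w / 2) ^ (2 * k) / ((k ! : ℂ) * (Real.Gamma (ν + k + 1) : ℂ))

/-- The `m`-th term `(w/2)^(bm) Ĩ_{b(m+ν)}(w) Č_m^ν(t)` of the series for `𝓘(b, ν, w, t)`
(principal branch of the power; at `w = 0` it is `1` for `m = 0` and `0` for `bm > 0`). -/
def scriptITerm (b ν : ℝ) (w : ℂ) (t : ℝ) (m : ℕ) : ℂ :=
  (w / 2) ^ ((b * m : ℝ) : ℂ) * normBesselI (b * (m + ν)) w * (normGegenbauer ν m t : ℂ)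

/-- `𝓘(b, ν, w, t) = Γ(bν + 1) ∑ₘ (w/2)^(bm) Ĩ_{b(m+ν)}(w) Č_m^ν(t)`. -/
def scriptI (b ν : ℝ) (w : ℂ) (t : ℝ) : ℂ :=
  (Real.Gamma (b * ν + 1) : ℂ) * ∑' m : ℕ, scriptITerm b ν w t m

/-- `λ_a = (N - 2) / a`. -/
def lambdaA (N : ℕ) (a : ℝ) : ℝ := ((N : ℝ) - 2) / a

/-- The normalizing constant `c_a = (∫ e^{-|x|^a / a} |x|^{a-2} dx)⁻¹`. -/
def constA (N : ℕ) (a : ℝ) : ℝ :=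
  (∫ x : EuclideanSpace ℝ (Fin N), Real.exp (-(‖x‖ ^ a / a)) * ‖x‖ ^ (a - 2))⁻¹

/-- The kernel `B_a(x, y)` of the `a`-generalized Fourier transform, given by
`B_a(rω, sμ) = 𝓘(2/a, (N-2)/2, 2 (rs)^{a/2} / (a i), ⟨ω, μ⟩)` in polar coordinates.
If `x` or `y` is `0`, then the third argument is `0` and the value does not depend on the fourth
one; see `fourierKernel_polar`. -/
def fourierKernel {N : ℕ} (a : ℝ) (x y : EuclideanSpace ℝ (Fin N)) : ℂ :=
  scriptI (2 / a) (((N : ℝ) - 2) / 2)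
    (((2 * (‖x‖ * ‖y‖) ^ (a / 2) : ℝ) : ℂ) / ((a : ℂ) * I))
    (inner ℝ x y / (‖x‖ * ‖y‖))

/-- The integrand `conj (B_a(x, ξ)) B_a(y, ξ) e^{-t|ξ|^a/a} |ξ|^{a-2}`. -/
def heatIntegrand {N : ℕ} (a : ℝ) (x y : EuclideanSpace ℝ (Fin N)) (t : ℝ)
    (ξ : EuclideanSpace ℝ (Fin N)) : ℂ :=
  conj (fourierKernel a x ξ) * fourierKernel a y ξ *
    ((Real.exp (-(t / a * ‖ξ‖ ^ a)) * ‖ξ‖ ^ (a - 2) : ℝ) : ℂ)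

/-- The `a`-deformed heat kernel `h_a(x, y; t)`. -/
def heatKernel {N : ℕ} (a : ℝ) (x y : EuclideanSpace ℝ (Fin N)) (t : ℝ) : ℂ :=
  (constA N a : ℂ) * ∫ ξ : EuclideanSpace ℝ (Fin N), heatIntegrand a x y t ξ

theorem scriptI_zero {b : ℝ} (hb : 0 < b) (ν t : ℝ) :
    scriptI b ν 0 t = (Real.Gamma (b * ν + 1) : ℂ) * normBesselI (b * ν) 0 := by
  unfold scriptI
  rw [tsum_eq_single 0]
  · simp [scriptITerm, normGegenbauer]
  · intro m hm
    have h : ((b * m : ℝ) : ℂ) ≠ 0 := by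
      exact_mod_cast mul_ne_zero hb.ne' (Nat.cast_ne_zero.mpr hm)
    rw [scriptITerm, zero_div, Complex.zero_cpow h]
    simp

/-- The formula for `B_a` in polar coordinates, for all radii `r, s ≥ 0`. -/
theorem fourierKernel_polar {N : ℕ} {a : ℝ} (ha : 0 < a) {r s : ℝ} (hr : 0 ≤ r) (hs : 0 ≤ s)
    {ω μ : EuclideanSpace ℝ (Fin N)} (hω : ‖ω‖ = 1) (hμ : ‖μ‖ = 1) :
    fourierKernel a (r • ω) (s • μ) =
      scriptI (2 / a) (((N : ℝ) - 2) / 2)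
        (((2 * (r * s) ^ (a / 2) : ℝ) : ℂ) / ((a : ℂ) * I)) (inner ℝ ω μ) := by
  have h1 : ‖r • ω‖ = r := by rw [norm_smul, hω, mul_one, Real.norm_of_nonneg hr]
  have h2 : ‖s • μ‖ = s := by rw [norm_smul, hμ, mul_one, Real.norm_of_nonneg hs]
  unfold fourierKernel
  rw [h1, h2]
  by_cases h : r * s = 0
  · rw [h, Real.zero_rpow (by positivity)]
    simp [scriptI_zero (show (0 : ℝ) < 2 / a by positivity)]
  · rw [real_inner_smul_left, real_inner_smul_right, ← mul_assoc, mul_div_cancel_left₀ _ h]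

end

/-! Expand both kernels in their Gegenbauer series and integrate in polar coordinates. The angular
integrals obey the reproducing formula `integral_gegPoly_mul_gegPoly`, ∫ Č_m(⟨ω,ξ⟩) Č_n(⟨μ,ξ⟩) dσ =
δ_{mn} |S^{N-1}| Č_n(⟨ω,μ⟩), so only equal degrees survive. In degree m the phases of the two powers
cancel under conjugation, and z = ρ^a/a turns the radial integral into Weber's second exponential
integral `integral_besselE_mul_besselE` of order α = (2m+N-2)/a with R = r^a/a, S = s^a/a. It
produces t^{-α-1} e^{-(R+S)/t} times a Bessel function at RS/t², which matches the m-th term of the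
right-hand side; c_a absorbs |S^{N-1}|, a^{λ_a} and one factor Γ(λ_a+1).

The reproducing formula is derived from sphere moments, uniformly in N ≥ 1. A Gaussian integral
gives the moments of ⟨w,ξ⟩, and w = μ + cω polarizes them. Orthogonality of Č_n to lower powers is
then the vanishing of a high finite difference of a polynomial of low degree, and the pairing with
the n-th power is a partial fraction identity. Weber's integral is computed termwise and resummed by
a Vandermonde identity.

The interchanges rest on `exists_norm_scriptITerm_le`: the terms are at most c_m e^{L|w|} with ∑ c_m
finite, and |w| is a multiple of |ξ|^{a/2} in the kernels, so the weight e^{-t|ξ|^a/a} wins. -/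

noncomputable section

/-! ### Explicit form and growth of the Gegenbauer polynomials -/

/-- The rising factorial `x (x + 1) ⋯ (x + n - 1)`. -/
abbrev poch (x : ℝ) (n : ℕ) : ℝ := (ascPochhammer ℝ n).eval x

theorem poch_succ (x : ℝ) (n : ℕ) : poch x (n + 1) = poch x n * (x + n) :=
  ascPochhammer_succ_eval n x

theorem poch_zero (x : ℝ) : poch x 0 = 1 := by simp [poch]

theorem poch_pos {x : ℝ} (hx : 0 < x) (n : ℕ) : 0 < poch x n := ascPochhammer_pos n x hx

theorem ring_choose_eq_poch (x : ℝ) (n : ℕ) : Ring.choose (x + n - 1) n = poch x n / n ! := by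
  rw [← Ring.multichoose_eq, eq_div_iff (by positivity), mul_comm]
  have := Ring.factorial_nsmul_multichoose_eq_ascPochhammer x n
  rw [Polynomial.ascPochhammer_smeval_eq_eval, nsmul_eq_mul] at this
  exact this

theorem hasSum_poch_pow (x : ℝ) {z : ℝ} (hz : |z| < 1) :
    HasSum (fun n : ℕ => poch x n / n ! * z ^ n) (1 / (1 - z) ^ x) := by
  have := (Real.one_div_one_sub_rpow_hasFPowerSeriesOnBall_zero x).hasSum (y := z)
    (by simpa [Metric.mem_eball, edist_dist, Real.dist_eq] using hz)
  simpa [ring_choose_eq_poch, FormalMultilinearSeries.ofScalars] using this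

theorem poch_binomial_expand (x X Y : ℝ) (n : ℕ) :
    ∑ p ∈ Finset.HasAntidiagonal.antidiagonal n,
        poch x (p.1 + p.2) / (p.1 ! * p.2 !) * X ^ p.1 * Y ^ p.2 =
      poch x n / n ! * (X + Y) ^ n := by
  rw [(Commute.all X Y).add_pow', Finset.mul_sum]
  refine Finset.sum_congr rfl fun p hp => ?_
  rw [Finset.HasAntidiagonal.mem_antidiagonal] at hp
  subst hp
  rw [nsmul_eq_mul, Nat.cast_add_choose]
  have := Nat.factorial_ne_zero (p.1 + p.2)
  field_simp

/-- Grouped by p + j = n, the absolute values add up to the binomial series at |X| + |Y|. -/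
theorem summable_poch_two_var {x : ℝ} (hx : 0 < x) {X Y : ℝ} (h : |X| + |Y| < 1) :
    Summable (fun p : ℕ × ℕ => |poch x (p.1 + p.2) / (p.1 ! * p.2 !) * X ^ p.1 * Y ^ p.2|) := by
  rw [← (Finset.HasAntidiagonal.sigmaAntidiagonalEquivProd (A := ℕ)).summable_iff]
  refine (summable_sigma_of_nonneg (fun _ => abs_nonneg _)).mpr
    ⟨fun n => (hasSum_fintype _).summable, ?_⟩
  have h1 := (hasSum_poch_pow x (z := |X| + |Y|) (by rwa [abs_of_nonneg (by positivity)])).summable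
  refine h1.congr fun n => ?_
  rw [← poch_binomial_expand, tsum_fintype, ← Finset.sum_coe_sort]
  refine Finset.sum_congr rfl fun p _ => ?_
  have := poch_pos hx (p.1.1 + p.1.2)
  simp only [Finset.HasAntidiagonal.sigmaAntidiagonalEquivProd_apply]
  rw [abs_mul, abs_mul, abs_pow, abs_pow,
    abs_of_nonneg (a := poch x _ / _) (by positivity)]

theorem hasSum_poch_two_var {x : ℝ} (hx : 0 < x) {X Y : ℝ} (h : |X| + |Y| < 1) :
    HasSum (fun p : ℕ × ℕ => poch x (p.1 + p.2) / (p.1 ! * p.2 !) * X ^ p.1 * Y ^ p.2)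
      (1 / (1 - (X + Y)) ^ x) := by
  have hs := (summable_poch_two_var hx h).of_abs.hasSum
  have h3 := ((Finset.HasAntidiagonal.sigmaAntidiagonalEquivProd (A := ℕ)).hasSum_iff.mpr hs).sigma
    (fun n => hasSum_fintype _)
  have h4 := hasSum_poch_pow x (z := X + Y) ((abs_add_le _ _).trans_lt h)
  have h5 := h4.unique (h3.congr_fun fun n => ?_)
  · rw [h5]; exact hs
  · rw [← poch_binomial_expand, ← Finset.sum_coe_sort]
    rfl

/-- Summing a double series along the fibres of `(p, j) ↦ p + 2 j`. -/
theorem HasSum.along_add_two_mul {F : ℕ × ℕ → ℝ} {S : ℝ} (h : HasSum F S) :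
    HasSum (fun n : ℕ => ∑ j ∈ Finset.range (n / 2 + 1), F (n - 2 * j, j)) S := by
  have h1 := h.tsum_fiberwise (fun p : ℕ × ℕ => p.1 + 2 * p.2)
  refine h1.congr_fun fun n => ?_
  have : ((fun p : ℕ × ℕ => p.1 + 2 * p.2) ⁻¹' {n}) =
      ((Finset.range (n / 2 + 1)).image (fun j => (n - 2 * j, j)) : Finset (ℕ × ℕ)) := by
    ext ⟨p, j⟩
    simp
    omega
  rw [this, Finset.tsum_subtype' , Finset.sum_image]
  intro i _ j _ hij
  simpa using congrArg Prod.snd hij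

/-- The absolute value of the coefficient of `(2t) ^ p` in `Č_{p + 2j}^ν(t)`. -/
def gegCoeff (ν : ℝ) (p j : ℕ) : ℝ :=
  (poch (ν + 1) (p + j) + j * poch (ν + 1) (p + j - 1)) / (p ! * j !)

theorem gegCoeff_nonneg {ν : ℝ} (hν : -1 < ν) (p j : ℕ) : 0 ≤ gegCoeff ν p j := by
  have h := fun n => (poch_pos (show 0 < ν + 1 by linarith) n).le
  have := h (p + j)
  have := h (p + j - 1)
  unfold gegCoeff
  positivity

/-- Multiplying the binomial series by Y shifts j by one, and 1/(j-1)! = j/j! gives the second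
summand of `gegCoeff`; its factor j makes the truncated p + j - 1 harmless at j = 0. -/
theorem hasSum_gegCoeff {ν : ℝ} (hν : -1 < ν) {X Y : ℝ} (h : |X| + |Y| < 1) :
    HasSum (fun p : ℕ × ℕ => gegCoeff ν p.1 p.2 * X ^ p.1 * Y ^ p.2)
      ((1 + Y) / (1 - (X + Y)) ^ (ν + 1)) := by
  have h1 := hasSum_poch_two_var (show 0 < ν + 1 by linarith) h
  have h2 := h1.mul_left Y
  have hinj : Function.Injective (fun p : ℕ × ℕ => (p.1, p.2 + 1)) := by
    rintro ⟨a, b⟩ ⟨c, d⟩ h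
    simpa using h
  have h3 : HasSum (fun p : ℕ × ℕ => p.2 * poch (ν + 1) (p.1 + p.2 - 1) / (p.1 ! * p.2 !) *
      X ^ p.1 * Y ^ p.2) (Y * (1 / (1 - (X + Y)) ^ (ν + 1))) := by
    rw [← hinj.hasSum_iff]
    · refine h2.congr_fun fun p => ?_
      have : (Nat.factorial (p.2 + 1) : ℝ) = (p.2 + 1) * p.2 ! := by
        push_cast [Nat.factorial_succ]; ring
      simp only [Function.comp, this]
      rw [show p.1 + (p.2 + 1) - 1 = p.1 + p.2 by omega]
      push_cast
      field_simp
      ring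
    · rintro ⟨p, j⟩ hp
      rcases j with _ | j
      · simp
      · exact absurd ⟨(p, j), rfl⟩ hp
  convert h1.add h3 using 2 with p
  · rw [gegCoeff]; ring
  · ring

/-- The explicit polynomial form of `Č_n^ν(t)`. -/
def gegPoly (ν : ℝ) (n : ℕ) (t : ℝ) : ℝ :=
  ∑ j ∈ Finset.range (n / 2 + 1), gegCoeff ν (n - 2 * j) j * (2 * t) ^ (n - 2 * j) * (-1) ^ j

/-- Take X = 2tx and Y = -x²; the monomial X^p Y^j has degree p + 2j in x. -/
theorem hasSum_gegPoly {ν : ℝ} (hν : -1 < ν) {t x : ℝ} (h : |2 * t * x| + |x ^ 2| < 1) :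
    HasSum (fun n : ℕ => gegPoly ν n t * x ^ n)
      ((1 - x ^ 2) / (1 - 2 * t * x + x ^ 2) ^ (ν + 1)) := by
  have h1 := (hasSum_gegCoeff hν (X := 2 * t * x) (Y := -x ^ 2)
    (by rwa [abs_neg])).along_add_two_mul
  convert h1 using 2 with n
  · rw [gegPoly, Finset.sum_mul]
    refine Finset.sum_congr rfl fun j hj => ?_
    have : x ^ n = x ^ (n - 2 * j) * (x ^ 2) ^ j := by
      rw [← pow_mul, ← pow_add]
      congr 1
      have := Finset.mem_range.mp hj
      omega
    rw [this, neg_pow (x ^ 2) j, mul_pow (2 * t) x]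
    ring
  · ring
  · congr 1; ring

theorem normGegenbauer_eq_gegPoly {ν : ℝ} (hν : -1 < ν) (n : ℕ) (t : ℝ) :
    normGegenbauer ν n t = gegPoly ν n t := by
  set f : ℝ → ℝ := fun x => (1 - x ^ 2) / (1 - 2 * t * x + x ^ 2) ^ (ν + 1) with hf
  have h1 : HasFPowerSeriesAt f (FormalMultilinearSeries.ofScalars ℝ (fun n => gegPoly ν n t)) 0 := by
    rw [hasFPowerSeriesAt_iff]
    have hc : Continuous (fun x : ℝ => |2 * t * x| + |x ^ 2|) := by fun_prop
    have := hc.tendsto' 0 0 (by simp)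
    filter_upwards [this.eventually_lt_const one_pos] with x hx
    simpa [mul_comm (gegPoly _ _ _)] using hasSum_gegPoly hν hx
  obtain ⟨r, hr⟩ := h1
  have h2 := hr.factorial_smul 1 n
  rw [← iteratedDeriv_eq_iteratedFDeriv] at h2
  rw [normGegenbauer, ← hf, ← h2]
  simp [FormalMultilinearSeries.ofScalars]
  field_simp

theorem continuous_gegPoly (ν : ℝ) (n : ℕ) : Continuous (gegPoly ν n) := by
  unfold gegPoly
  fun_prop

/-- At X = 1/2, Y = 1/16 (x = 1/4, t = 1, with the sign of Y reversed) the double series still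
converges and has nonnegative terms, so its sum C bounds each block of degree n. -/
theorem exists_abs_gegPoly_le {ν : ℝ} (hν : -1 < ν) :
    ∃ C : ℝ, 0 ≤ C ∧ ∀ n : ℕ, ∀ t : ℝ, |t| ≤ 1 → |gegPoly ν n t| ≤ C * 4 ^ n := by
  have h1 := (hasSum_gegCoeff hν (X := 1 / 2) (Y := 1 / 16)
    (by norm_num [abs_of_pos])).along_add_two_mul
  have hnn : ∀ n : ℕ, 0 ≤ ∑ j ∈ Finset.range (n / 2 + 1),
      gegCoeff ν (n - 2 * j) j * (1 / 2) ^ (n - 2 * j) * (1 / 16) ^ j := fun n =>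
    Finset.sum_nonneg fun j _ => by have := gegCoeff_nonneg hν (n - 2 * j) j; positivity
  refine ⟨_, h1.nonneg hnn, fun n t ht => ?_⟩
  have h2 := le_hasSum h1 n fun m _ => hnn m
  refine le_trans ?_ (mul_le_mul_of_nonneg_right h2 (by positivity))
  rw [gegPoly, Finset.sum_mul]
  refine (Finset.abs_sum_le_sum_abs _ _).trans (Finset.sum_le_sum fun j hj => ?_)
  have h3 := gegCoeff_nonneg hν (n - 2 * j) j
  have h4 : (4 : ℝ) ^ n = 4 ^ (n - 2 * j) * 16 ^ j := by
    rw [show (16 : ℝ) = 4 ^ 2 by norm_num, ← pow_mul, ← pow_add]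
    congr 1
    have := Finset.mem_range.mp hj
    omega
  rw [abs_mul, abs_mul, abs_pow, abs_pow, abs_of_nonneg h3, h4, abs_neg, abs_one, one_pow, mul_one]
  have h5 : |2 * t| ≤ 2 := by rw [abs_mul, abs_two]; linarith
  calc gegCoeff ν (n - 2 * j) j * |2 * t| ^ (n - 2 * j)
      ≤ gegCoeff ν (n - 2 * j) j * 2 ^ (n - 2 * j) := by gcongr
    _ = gegCoeff ν (n - 2 * j) j * ((1 / 2 * 4) ^ (n - 2 * j)) * (1 / 16 * 16) ^ j := by norm_num
    _ = _ := by rw [mul_pow, mul_pow]; ring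

/-! ### Moments of a linear form on the unit sphere -/

theorem Gamma_add_natCast_eq_poch {x : ℝ} (hx : 0 < x) (n : ℕ) :
    Real.Gamma (x + n) = poch x n * Real.Gamma x := by
  induction n with
  | zero => simp [poch_zero]
  | succ n ih =>
    rw [Nat.cast_succ, ← add_assoc, Real.Gamma_add_one (by positivity), ih, poch_succ]
    ring

theorem powerSeries_coeff_unique {a b : ℕ → ℝ} {f : ℝ → ℝ}
    (ha : ∀ c : ℝ, HasSum (fun k => a k * c ^ k) (f c))
    (hb : ∀ c : ℝ, HasSum (fun k => b k * c ^ k) (f c)) : a = b := by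
  have key : ∀ a : ℕ → ℝ, (∀ c : ℝ, HasSum (fun k => a k * c ^ k) (f c)) →
      HasFPowerSeriesAt f (FormalMultilinearSeries.ofScalars ℝ a) 0 := fun a ha => by
    rw [hasFPowerSeriesAt_iff]
    refine Filter.Eventually.of_forall fun c => ?_
    simpa [mul_comm (a _)] using ha c
  have := (key a ha).eq_formalMultilinearSeries (key b hb)
  funext n
  simpa using congrArg (fun p => FormalMultilinearSeries.coeff p n) this

section Sphere

variable {E : Type*} [NormedAddCommGroup E] [InnerProductSpace ℝ E] [FiniteDimensional ℝ E]
  [MeasurableSpace E] [BorelSpace E]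

/-- Integration in polar coordinates of a product of a radial and an angular function. -/
theorem integral_radial_mul_angular [Nontrivial E] {𝕜 : Type*} [RCLike 𝕜]
    (f : ℝ → 𝕜) (g : E → 𝕜) :
    ∫ x : E, f ‖x‖ * g (‖x‖⁻¹ • x) =
      (∫ ξ : Metric.sphere (0 : E) 1, g ξ ∂(volume : Measure E).toSphere) *
        ∫ ρ in Set.Ioi (0 : ℝ), ((ρ ^ (Module.finrank ℝ E - 1) : ℝ) : 𝕜) * f ρ := by
  calc
    ∫ x : E, f ‖x‖ * g (‖x‖⁻¹ • x)
      = ∫ x : ({(0)}ᶜ : Set E), f ‖x.1‖ * g (‖x.1‖⁻¹ • x.1) ∂((volume : Measure E).comap (↑)) := by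
      rw [integral_subtype_comap (measurableSet_singleton _).compl
        fun x : E ↦ f ‖x‖ * g (‖x‖⁻¹ • x), restrict_compl_singleton]
    _ = ∫ x : Metric.sphere (0 : E) 1 × Set.Ioi (0 : ℝ), g x.1 * f x.2
          ∂(volume : Measure E).toSphere.prod (.volumeIoiPow (Module.finrank ℝ E - 1)) := by
      have := (volume : Measure E).measurePreserving_homeomorphUnitSphereProd.integral_comp
        (Homeomorph.measurableEmbedding _)
        (fun x : Metric.sphere (0 : E) 1 × Set.Ioi (0 : ℝ) => g x.1 * f x.2)
      rw [← this]
      simp [mul_comm]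
    -- `integral_prod_mul` needs no integrability, so f and g can be arbitrary.
    _ = (∫ ξ : Metric.sphere (0 : E) 1, g ξ ∂(volume : Measure E).toSphere) *
          ∫ x : Set.Ioi (0 : ℝ), f x ∂.volumeIoiPow (Module.finrank ℝ E - 1) :=
      integral_prod_mul (fun ξ : Metric.sphere (0 : E) 1 => g ξ) (fun x : Set.Ioi (0 : ℝ) => f x)
    _ = _ := by
      congr 1
      simp only [Measure.volumeIoiPow, ENNReal.ofReal]
      rw [integral_withDensity_eq_integral_smul,
        integral_subtype_comap measurableSet_Ioi
          fun a ↦ Real.toNNReal (a ^ (Module.finrank ℝ E - 1)) • f a,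
        setIntegral_congr_fun measurableSet_Ioi fun x hx ↦ ?_]
      · rw [NNReal.smul_def, Real.coe_toNNReal _ (pow_nonneg hx.out.le _), RCLike.real_smul_eq_coe_mul]
      · exact (measurable_subtype_coe.pow_const _).real_toNNReal

theorem integral_rexp_neg_norm_sq_add_inner (w : E) (c : ℝ) :
    ∫ v : E, Real.exp (-‖v‖ ^ 2) * Real.exp (c * inner ℝ w v) =
      Real.pi ^ ((Module.finrank ℝ E : ℝ) / 2) * Real.exp (c ^ 2 * ‖w‖ ^ 2 / 4) := by
  have h := GaussianFourier.integral_cexp_neg_mul_sq_norm_add (b := 1) (by simp) (c : ℂ) w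
  have h2 : ∀ v : E, cexp (-1 * (‖v‖ : ℂ) ^ 2 + c * ((inner ℝ w v : ℝ) : ℂ)) =
      ((Real.exp (-‖v‖ ^ 2) * Real.exp (c * inner ℝ w v) : ℝ) : ℂ) := fun v => by
    rw [← Real.exp_add]; push_cast; ring_nf
  simp_rw [h2] at h
  rw [integral_complex_ofReal] at h
  have h3 : ((Real.pi : ℂ) / 1) ^ ((Module.finrank ℝ E : ℂ) / 2) =
      ((Real.pi ^ ((Module.finrank ℝ E : ℝ) / 2) : ℝ) : ℂ) := by
    rw [Complex.ofReal_cpow Real.pi_pos.le]; push_cast; simp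
  rw [h3] at h
  apply Complex.ofReal_injective
  rw [h]
  push_cast
  ring_nf

theorem integrable_rexp_neg_sq_add_linear (A : ℝ) :
    Integrable (fun v : E => Real.exp (A * ‖v‖) * Real.exp (-‖v‖ ^ 2)) := by
  -- The majorant comes from A‖v‖ ≤ A²/2 + ‖v‖²/2, which spends half of the Gaussian.
  have h := (GaussianFourier.integrable_cexp_neg_mul_sq_norm_add (V := E) (b := 1 / 2) (by simp)
    0 0).norm.const_mul (Real.exp (A ^ 2 / 2))
  refine h.mono' (by fun_prop) (Filter.Eventually.of_forall fun v => ?_)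
  rw [Complex.norm_exp, Real.norm_of_nonneg (by positivity), ← Real.exp_add, ← Real.exp_add]
  refine Real.exp_le_exp.mpr ?_
  have : (-(1 / 2 : ℂ) * (‖v‖ : ℂ) ^ 2 + 0 * ((inner ℝ (0 : E) v : ℝ) : ℂ)).re = -(1 / 2) * ‖v‖ ^ 2 := by
    rw [zero_mul, add_zero]
    have : (-(1 / 2 : ℂ) * (‖v‖ : ℂ) ^ 2) = ((-(1 / 2) * ‖v‖ ^ 2 : ℝ) : ℂ) := by push_cast; ring
    rw [this, Complex.ofReal_re]
  rw [this]
  nlinarith [sq_nonneg (A - ‖v‖)]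

theorem integral_pow_mul_rexp_neg_sq (n : ℕ) :
    ∫ ρ in Set.Ioi (0 : ℝ), ρ ^ n * Real.exp (-ρ ^ 2) = Real.Gamma (((n : ℝ) + 1) / 2) / 2 := by
  have h := integral_rpow_mul_exp_neg_mul_rpow (p := 2) (q := n) (b := 1) two_pos
    (by have : (0 : ℝ) ≤ n := n.cast_nonneg
        linarith) one_pos
  rw [Real.one_rpow] at h
  rw [show Real.Gamma (((n : ℝ) + 1) / 2) / 2 = 1 * (1 / 2) * Real.Gamma (((n : ℝ) + 1) / 2) by ring,
    ← h]
  refine setIntegral_congr_fun measurableSet_Ioi fun x _ => ?_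
  simp

/-- Expand exp(c⟨w,v⟩) against the Gaussian: in polar coordinates the k-th term splits into the k-th
sphere moment and a radial Gamma integral. -/
theorem hasSum_sphere_moments [Nontrivial E] (w : E) (c : ℝ) :
    HasSum (fun k : ℕ =>
      ((∫ ξ : Metric.sphere (0 : E) 1, (inner ℝ w (ξ : E)) ^ k ∂(volume : Measure E).toSphere) *
        (Real.Gamma (((Module.finrank ℝ E : ℝ) + k) / 2) / 2) / k !) * c ^ k)
      (Real.pi ^ ((Module.finrank ℝ E : ℝ) / 2) * Real.exp (c ^ 2 * ‖w‖ ^ 2 / 4)) := by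
  rw [← integral_rexp_neg_norm_sq_add_inner]
  have hd : 1 ≤ Module.finrank ℝ E := Module.finrank_pos
  have key : HasSum (fun k : ℕ => ∫ v : E, Real.exp (-‖v‖ ^ 2) * ((c * inner ℝ w v) ^ k / k !))
      (∫ v : E, Real.exp (-‖v‖ ^ 2) * Real.exp (c * inner ℝ w v)) := by
    have hexp : ∀ x : ℝ, HasSum (fun k : ℕ => x ^ k / (k ! : ℝ)) (Real.exp x) := fun x => by
      rw [Real.exp_eq_exp_ℝ]; exact NormedSpace.expSeries_div_hasSum_exp x
    refine hasSum_integral_of_dominated_convergence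
      (fun k v => Real.exp (-‖v‖ ^ 2) * ((|c| * ‖w‖ * ‖v‖) ^ k / k !)) (fun k => ?_)
      (fun k => Filter.Eventually.of_forall fun v => ?_)
      (Filter.Eventually.of_forall fun v => (hexp _).summable.mul_left _) ?_
      (Filter.Eventually.of_forall fun v => (hexp _).mul_left _)
    · exact (by fun_prop : Continuous fun v : E =>
        Real.exp (-‖v‖ ^ 2) * ((c * inner ℝ w v) ^ k / k !)).aestronglyMeasurable
    · rw [norm_mul, norm_div, norm_pow, norm_mul, Real.norm_of_nonneg (Real.exp_pos _).le,
        Real.norm_eq_abs c, Real.norm_of_nonneg (Nat.cast_nonneg (k !)), mul_assoc |c|]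
      gcongr
      exact norm_inner_le_norm w v
    · simp_rw [tsum_mul_left, (hexp _).tsum_eq, mul_comm (Real.exp (-_))]
      exact integrable_rexp_neg_sq_add_linear (E := E) _
  refine key.congr_fun fun k => ?_
  have h1 : ∀ v : E, Real.exp (-‖v‖ ^ 2) * ((c * inner ℝ w v) ^ k / k !) =
      (c ^ k / k ! * (Real.exp (-‖v‖ ^ 2) * ‖v‖ ^ k)) * (inner ℝ w (‖v‖⁻¹ • v)) ^ k := fun v => by
    rcases eq_or_ne v 0 with rfl | hv
    · rcases k with _ | k <;> simp
    · have := norm_ne_zero_iff.mpr hv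
      rw [real_inner_smul_right, mul_pow, mul_pow, inv_pow]
      field_simp
  simp_rw [h1]
  rw [integral_radial_mul_angular (E := E) (𝕜 := ℝ)
    (fun ρ => c ^ k / k ! * (Real.exp (-ρ ^ 2) * ρ ^ k)) (fun x => (inner ℝ w x) ^ k)]
  have h2 : ∫ ρ in Set.Ioi (0 : ℝ), ((ρ ^ (Module.finrank ℝ E - 1) : ℝ) : ℝ) *
      (c ^ k / k ! * (Real.exp (-ρ ^ 2) * ρ ^ k)) =
      c ^ k / k ! * (Real.Gamma (((Module.finrank ℝ E : ℝ) + k) / 2) / 2) := by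
    have h3 := integral_pow_mul_rexp_neg_sq (Module.finrank ℝ E - 1 + k)
    rw [show (((Module.finrank ℝ E - 1 + k : ℕ) : ℝ) + 1) = (Module.finrank ℝ E : ℝ) + k by
      push_cast [Nat.cast_sub hd]; ring] at h3
    rw [← h3, ← integral_const_mul]
    congr 1
    funext ρ
    rw [pow_add]; ring
  erw [h2]
  ring

theorem sphere_moments [Nontrivial E] (w : E) :
    (∀ h : ℕ, ∫ ξ : Metric.sphere (0 : E) 1, (inner ℝ w (ξ : E)) ^ (2 * h)
        ∂(volume : Measure E).toSphere =
      (volume : Measure E).toSphere.real Set.univ * ((2 * h)! /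
        (4 ^ h * h ! * poch ((Module.finrank ℝ E : ℝ) / 2) h)) * (‖w‖ ^ 2) ^ h) ∧
    ∀ h : ℕ, ∫ ξ : Metric.sphere (0 : E) 1, (inner ℝ w (ξ : E)) ^ (2 * h + 1)
        ∂(volume : Measure E).toSphere = 0 := by
  set d : ℝ := (Module.finrank ℝ E : ℝ) with hd
  have hd0 : 0 < d := Nat.cast_pos.mpr Module.finrank_pos
  set b : ℕ → ℝ := fun k => if Even k then
    Real.pi ^ (d / 2) * ((‖w‖ ^ 2) ^ (k / 2) / (4 ^ (k / 2) * (k / 2)!)) else 0 with hb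
  have h1 : ∀ c : ℝ, HasSum (fun k => b k * c ^ k)
      (Real.pi ^ (d / 2) * Real.exp (c ^ 2 * ‖w‖ ^ 2 / 4)) := fun c => by
    have hinj : Function.Injective (fun h : ℕ => 2 * h) := fun x y h => by simpa using h
    rw [← hinj.hasSum_iff]
    · rw [Real.exp_eq_exp_ℝ]
      have h0 := (NormedSpace.expSeries_div_hasSum_exp (c ^ 2 * ‖w‖ ^ 2 / 4)).mul_left
        (Real.pi ^ (d / 2))
      refine h0.congr_fun fun h => ?_
      simp only [Function.comp, hb, even_two_mul, if_true]
      rw [Nat.mul_div_cancel_left _ two_pos, pow_mul, div_pow, mul_pow]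
      field_simp
    · intro k hk
      have : ¬ Even k := fun ⟨m, hm⟩ => hk ⟨m, by simp [hm, two_mul]⟩
      simp [hb, this]
  have h2 := powerSeries_coeff_unique (hasSum_sphere_moments w) h1
  have hG : Real.Gamma (d / 2) ≠ 0 := (Real.Gamma_pos_of_pos (by positivity)).ne'
  -- The coefficient of c⁰ gives the area of the sphere and removes π from the other moments.
  have hpi : (volume : Measure E).toSphere.real Set.univ * (Real.Gamma (d / 2) / 2) =
      Real.pi ^ (d / 2) := by
    have := congrFun h2 0
    simpa [hb] using this
  constructor
  · intro h
    have h3 := congrFun h2 (2 * h)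
    simp only [hb, even_two_mul, if_true, Nat.mul_div_cancel_left _ two_pos] at h3
    rw [← hpi, show (d + (2 * h : ℕ)) / 2 = d / 2 + h by push_cast; ring,
      Gamma_add_natCast_eq_poch (by positivity)] at h3
    have hp := (poch_pos (show 0 < d / 2 by positivity) h).ne'
    have hf : ((2 * h)! : ℝ) ≠ 0 := by positivity
    field_simp at h3 ⊢
    linear_combination h3
  · intro h
    have h3 := congrFun h2 (2 * h + 1)
    have : ¬ Even (2 * h + 1) := by simp
    simp only [hb, this, if_false] at h3
    have hG2 : Real.Gamma ((d + (2 * h + 1 : ℕ)) / 2) ≠ 0 :=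
      (Real.Gamma_pos_of_pos (by positivity)).ne'
    have hf : ((2 * h + 1)! : ℝ) ≠ 0 := by positivity
    have h4 := (div_eq_zero_iff.mp h3).resolve_right hf
    exact (mul_eq_zero.mp h4).resolve_right (div_ne_zero hG2 two_ne_zero)

end Sphere

/-! ### Finite differences and partial fractions -/

/-- By Pascal's rule, the difference of order M + 1 is the M-th difference of a first difference. -/
theorem sum_alternating_choose_succ (M : ℕ) (f : ℕ → ℝ) :
    ∑ j ∈ Finset.range (M + 2), (-1) ^ j * ((M + 1).choose j : ℝ) * f j =
      ∑ j ∈ Finset.range (M + 1), (-1) ^ j * (M.choose j : ℝ) * (f j - f (j + 1)) := by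
  have h1 : ∑ j ∈ Finset.range (M + 1), (-1) ^ j * (M.choose j : ℝ) * f j =
      ∑ j ∈ Finset.range (M + 1), (-1) ^ (j + 1) * (M.choose (j + 1) : ℝ) * f (j + 1) + f 0 := by
    rw [Finset.sum_range_succ', Finset.sum_range_succ
      (fun j => (-1) ^ (j + 1) * (M.choose (j + 1) : ℝ) * f (j + 1))]
    simp
  rw [Finset.sum_range_succ']
  simp only [mul_sub, Finset.sum_sub_distrib]
  rw [h1, add_sub_right_comm, ← Finset.sum_sub_distrib]
  simp only [Nat.choose_succ_succ, Nat.cast_add, Nat.choose_zero_right, pow_zero, Nat.cast_one, one_mul]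
  congr 1
  refine Finset.sum_congr rfl fun j _ => ?_
  ring

theorem poch_succ_left (x : ℝ) (n : ℕ) : poch x (n + 1) = x * poch (x + 1) n := by
  simp [poch, ascPochhammer_succ_left, Polynomial.eval_comp]

theorem poch_add (x : ℝ) (m n : ℕ) : poch x (m + n) = poch x m * poch (x + m) n := by
  induction n with
  | zero => simp [poch_zero]
  | succ n ih =>
    rw [← add_assoc, poch_succ, ih, poch_succ]
    push_cast
    ring

theorem poch_sub_poch (x : ℝ) (m : ℕ) :
    poch x (m + 1) - poch (x - 1) (m + 1) = (m + 1) * poch x m := by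
  rw [poch_succ_left (x - 1), poch_succ, sub_add_cancel]
  ring

/-- An M-th difference kills polynomials of degree m < M; each first difference lowers the degree of
the rising factorial by `poch_sub_poch`. -/
theorem sum_alternating_choose_poch_eq_zero (M : ℕ) : ∀ (m : ℕ) (_ : m < M) (y : ℝ),
    ∑ j ∈ Finset.range (M + 1), (-1) ^ j * (M.choose j : ℝ) * poch (y - j) m = 0 := by
  induction M with
  | zero => intro m hm; omega
  | succ M ih =>
    intro m hm y
    rw [sum_alternating_choose_succ M (fun j => poch (y - j) m)]
    rcases m with _ | m
    · simp [poch_zero]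
    · have : ∀ j : ℕ, poch (y - j) (m + 1) - poch (y - (j + 1 : ℕ)) (m + 1) =
          (m + 1) * poch (y - j) m := fun j => by
        rw [← poch_sub_poch]; push_cast; ring_nf
      simp_rw [this]
      have h := ih m (by omega) y
      calc _ = (m + 1) * ∑ j ∈ Finset.range (M + 1), (-1) ^ j * (M.choose j : ℝ) * poch (y - j) m := by
            rw [Finset.mul_sum]
            exact Finset.sum_congr rfl fun j _ => by ring
        _ = 0 := by rw [h, mul_zero]

/-- This is the partial fraction expansion of M!/∏(x - i), up to sign. -/
theorem sum_alternating_choose_inv (M : ℕ) : ∀ (x : ℝ) (_ : ∀ i : ℕ, i ≤ M → x - i ≠ 0),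
    ∑ j ∈ Finset.range (M + 1), (-1) ^ j * (M.choose j : ℝ) * (1 / (x - j)) =
      (-1) ^ M * M ! / ∏ i ∈ Finset.range (M + 1), (x - i) := by
  induction M with
  | zero => intro x _; simp
  | succ M ih =>
    intro x hx
    rw [sum_alternating_choose_succ M (fun j => 1 / (x - j))]
    simp only [mul_sub, Finset.sum_sub_distrib]
    have h1 := ih x fun i hi => hx i (by omega)
    have h2 := ih (x - 1) fun i hi => by
      have := hx (i + 1) (by omega)
      push_cast at this
      rwa [sub_sub, add_comm 1]
    have h3 : ∀ j : ℕ, x - (j + 1 : ℕ) = x - 1 - j := fun j => by push_cast; ring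
    simp_rw [h3]
    rw [h1, h2]
    have h4 : ∏ i ∈ Finset.range (M + 2), (x - (i : ℝ)) =
        (∏ i ∈ Finset.range (M + 1), (x - (i : ℝ))) * (x - (M + 1 : ℕ)) :=
      Finset.prod_range_succ _ _
    have h5 : ∏ i ∈ Finset.range (M + 2), (x - (i : ℝ)) =
        (∏ i ∈ Finset.range (M + 1), (x - 1 - (i : ℝ))) * x := by
      rw [Finset.prod_range_succ']
      simp_rw [h3]
      simp
    have h6 : ∏ i ∈ Finset.range (M + 2), (x - (i : ℝ)) ≠ 0 :=
      Finset.prod_ne_zero_iff.mpr fun i hi => hx i (by have := Finset.mem_range.mp hi; omega)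
    -- The full product is P (x - (M + 1)) and also Q x; it serves as the common denominator of 1/P
    -- and 1/Q.
    have h7 := (mul_ne_zero_iff.mp (h4 ▸ h6))
    have h8 := (mul_ne_zero_iff.mp (h5 ▸ h6))
    have h9 := h4.symm.trans h5
    rw [h4]
    set P := ∏ i ∈ Finset.range (M + 1), (x - (i : ℝ))
    set Q := ∏ i ∈ Finset.range (M + 1), (x - 1 - (i : ℝ))
    have hP := h7.1
    have hy := h7.2
    have hQ := h8.1
    have hxx := h8.2
    have e1 : (1 : ℝ) / Q = x / (P * (x - (M + 1 : ℕ))) := by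
      rw [h9]; field_simp
    have e2 : (1 : ℝ) / P = (x - (M + 1 : ℕ)) / (P * (x - (M + 1 : ℕ))) := by
      field_simp
    rw [div_eq_mul_one_div _ P, div_eq_mul_one_div _ Q, e1, e2]
    rw [Nat.factorial_succ]
    push_cast
    ring

theorem prod_range_mul_poch (x : ℝ) (n l : ℕ) (h : l ≤ n) :
    (∏ i ∈ Finset.range l, (x + n - 1 - i)) * poch x (n - l) = poch x n := by
  induction l with
  | zero => simp
  | succ l ih =>
    rw [← ih (by omega), Finset.prod_range_succ, show n - l = (n - (l + 1)) + 1 by omega, poch_succ,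
      Nat.cast_sub h]
    push_cast
    ring

/-! ### Mixed sphere moments and the reproducing formula -/

theorem continuous_gegPoly_inner {E : Type*} [NormedAddCommGroup E] [InnerProductSpace ℝ E]
    (ν : ℝ) (n : ℕ) (x : E) :
    Continuous (fun ξ : Metric.sphere (0 : E) 1 => gegPoly ν n (inner ℝ x (ξ : E))) :=
  (continuous_gegPoly ν n).comp (by fun_prop)

section Sphere

variable {E : Type*} [NormedAddCommGroup E] [InnerProductSpace ℝ E] [FiniteDimensional ℝ E]
  [MeasurableSpace E] [BorelSpace E]

theorem integrable_sphere {F : Type*} [NormedAddCommGroup F] {f : Metric.sphere (0 : E) 1 → F}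
    (hf : Continuous f) :
    Integrable f (volume : Measure E).toSphere :=
  hf.integrable_of_hasCompactSupport (HasCompactSupport.of_compactSpace _)

/-- The mixed moment `∫ ⟨μ, ξ⟩ ^ p ⟨ω, ξ⟩ ^ k` over the unit sphere. -/
def sphereMoment (μ ω : E) (p k : ℕ) : ℝ :=
  ∫ ξ : Metric.sphere (0 : E) 1, (inner ℝ μ (ξ : E)) ^ p * (inner ℝ ω (ξ : E)) ^ k
    ∂(volume : Measure E).toSphere

/-- Polarization: the mixed moments are the coefficients in c of the pure moment at μ + cω. The
finite binomial sum is written as a power series so that coefficients can be compared. -/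
theorem hasSum_sphereMoment (μ ω : E) (m : ℕ) (c : ℝ) :
    HasSum (fun k : ℕ => ((m.choose k : ℝ) * sphereMoment μ ω (m - k) k) * c ^ k)
      (∫ ξ : Metric.sphere (0 : E) 1, (inner ℝ (μ + c • ω) (ξ : E)) ^ m
        ∂(volume : Measure E).toSphere) := by
  have h : ∀ ξ : Metric.sphere (0 : E) 1, (inner ℝ (μ + c • ω) (ξ : E)) ^ m =
      ∑ k ∈ Finset.range (m + 1), ((m.choose k : ℝ) * c ^ k) *
        ((inner ℝ μ (ξ : E)) ^ (m - k) * (inner ℝ ω (ξ : E)) ^ k) := fun ξ => by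
    rw [inner_add_left, real_inner_smul_left, add_comm, add_pow]
    refine Finset.sum_congr rfl fun k _ => ?_
    rw [mul_pow]; ring
  simp_rw [h]
  rw [integral_finsetSum _ fun k _ => integrable_sphere (by fun_prop)]
  simp_rw [integral_const_mul]
  have h2 := hasSum_sum_of_ne_finset_zero (L := SummationFilter.unconditional ℕ) (s := Finset.range (m + 1))
    (f := fun k : ℕ => ((m.choose k : ℝ) * sphereMoment μ ω (m - k) k) * c ^ k) (fun k hk => by
      rw [Nat.choose_eq_zero_of_lt (by simpa using hk)]; simp)
  convert h2 using 1
  refine Finset.sum_congr rfl fun k _ => ?_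
  rw [sphereMoment]; ring

theorem sphereMoment_eq_zero_of_odd [Nontrivial E] (μ ω : E) {p k : ℕ} (h : Odd (p + k)) :
    sphereMoment μ ω p k = 0 := by
  obtain ⟨m, hm⟩ := h
  have h1 : ∀ c : ℝ, HasSum (fun k => (0 : ℝ) * c ^ k)
      (∫ ξ : Metric.sphere (0 : E) 1, (inner ℝ (μ + c • ω) (ξ : E)) ^ (2 * m + 1)
        ∂(volume : Measure E).toSphere) := fun c => by
    rw [(sphere_moments _).2]
    simp
  have h2 := congrFun (powerSeries_coeff_unique (hasSum_sphereMoment μ ω (2 * m + 1)) h1) k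
  have h3 : ((2 * m + 1).choose k : ℝ) ≠ 0 := by
    exact_mod_cast (Nat.choose_pos (by omega)).ne'
  rw [show 2 * m + 1 - k = p by omega] at h2
  exact (mul_eq_zero.mp h2).resolve_left h3

/-- Here l counts the factors c² and k - 2l the factors 2τc. For unit vectors with ⟨ω,μ⟩ = τ the
base is ‖μ + cω‖². -/
theorem hasSum_trinomial (τ c : ℝ) (h : ℕ) :
    HasSum (fun k : ℕ => (∑ l ∈ Finset.range (k / 2 + 1),
      (h.choose l : ℝ) * (h - l).choose (k - 2 * l) * (2 * τ) ^ (k - 2 * l)) * c ^ k)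
      ((1 + 2 * τ * c + c ^ 2) ^ h) := by
  have h1 : HasSum (fun p : ℕ × ℕ => (h.choose p.2 : ℝ) * (h - p.2).choose p.1 * (2 * τ) ^ p.1 *
      c ^ (p.1 + 2 * p.2)) ((1 + 2 * τ * c + c ^ 2) ^ h) := by
    have h2 := hasSum_sum_of_ne_finset_zero (L := SummationFilter.unconditional (ℕ × ℕ))
      (s := Finset.range (h + 1) ×ˢ Finset.range (h + 1))
      (f := fun p : ℕ × ℕ => (h.choose p.2 : ℝ) * (h - p.2).choose p.1 * (2 * τ) ^ p.1 *
      c ^ (p.1 + 2 * p.2)) (fun p hp => by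
        rw [Finset.mem_product, Finset.mem_range, Finset.mem_range] at hp
        rcases Nat.lt_or_ge h p.2 with h3 | h3
        · simp [Nat.choose_eq_zero_of_lt h3]
        · rw [Nat.choose_eq_zero_of_lt (show h - p.2 < p.1 by omega)]; simp)
    convert h2 using 1
    rw [add_comm (1 + 2 * τ * c), add_pow, Finset.sum_product_right]
    refine Finset.sum_congr rfl fun l hl => ?_
    rw [add_comm 1, add_pow, Finset.mul_sum, Finset.sum_mul]
    have h4 : Finset.range (h - l + 1) ⊆ Finset.range (h + 1) := by
      intro i; simp; omega
    rw [← Finset.sum_subset h4]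
    · refine Finset.sum_congr rfl fun i _ => ?_
      rw [pow_add, pow_mul c 2, mul_pow (2 * τ) c]
      ring
    · intro i _ hi
      rw [Nat.choose_eq_zero_of_lt (show h - l < i by simpa using hi)]; simp
  refine h1.along_add_two_mul.congr_fun fun k => ?_
  rw [Finset.sum_mul]
  refine Finset.sum_congr rfl fun l hl => ?_
  have := Finset.mem_range.mp hl
  rw [show k - 2 * l + 2 * l = k by omega]

theorem sphereMoment_of_even [Nontrivial E] {μ ω : E} (hμ : ‖μ‖ = 1) (hω : ‖ω‖ = 1) {p k h : ℕ}
    (hpk : p + k = 2 * h) :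
    sphereMoment μ ω p k = (volume : Measure E).toSphere.real Set.univ * (p ! * k ! /
        (4 ^ h * h ! * poch ((Module.finrank ℝ E : ℝ) / 2) h)) *
      ∑ l ∈ Finset.range (k / 2 + 1),
        (h.choose l : ℝ) * (h - l).choose (k - 2 * l) * (2 * inner ℝ ω μ) ^ (k - 2 * l) := by
  set κ : ℝ := (volume : Measure E).toSphere.real Set.univ * ((2 * h)! /
        (4 ^ h * h ! * poch ((Module.finrank ℝ E : ℝ) / 2) h)) with hκ
  have h1 : ∀ c : ℝ, HasSum (fun k => (κ * ∑ l ∈ Finset.range (k / 2 + 1),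
        (h.choose l : ℝ) * (h - l).choose (k - 2 * l) * (2 * inner ℝ ω μ) ^ (k - 2 * l)) * c ^ k)
      (∫ ξ : Metric.sphere (0 : E) 1, (inner ℝ (μ + c • ω) (ξ : E)) ^ (2 * h)
        ∂(volume : Measure E).toSphere) := fun c => by
    rw [(sphere_moments _).1]
    have h2 : ‖μ + c • ω‖ ^ 2 = 1 + 2 * inner ℝ ω μ * c + c ^ 2 := by
      rw [norm_add_sq_real, hμ, norm_smul, hω, real_inner_smul_right, real_inner_comm]
      simp
      ring
    rw [h2]
    have h3 := (hasSum_trinomial (inner ℝ ω μ) c h).mul_left κ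
    refine h3.congr_fun fun k => ?_
    ring
  have h2 := congrFun (powerSeries_coeff_unique (hasSum_sphereMoment μ ω (2 * h)) h1) k
  have h3 : ((2 * h).choose k : ℝ) = (2 * h)! / (p ! * k !) := by
    rw [← hpk, add_comm p k, Nat.cast_add_choose, mul_comm (k ! : ℝ)]
  rw [show 2 * h - k = p by omega, h3] at h2
  have hf : ((2 * h)! : ℝ) ≠ 0 := by positivity
  have hp : (p ! : ℝ) ≠ 0 := by positivity
  have hk : (k ! : ℝ) ≠ 0 := by positivity
  calc sphereMoment μ ω p k
      = (p ! * k ! / (2 * h)!) * ((2 * h)! / (p ! * k !) * sphereMoment μ ω p k) := by field_simp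
    _ = _ := by rw [h2, hκ]; field_simp

/-- This collects the coefficient of (2⟨ω,μ⟩)^(k-2l). The factorials combine into the binomial
coefficients of order e + l, so the sum over j becomes a finite difference. -/
theorem sum_gegCoeff_mul_sphereMoment_summand {ν δ : ℝ} (hν : ν + 1 = δ) (hδ : 0 < δ)
    (S : ℝ) {n k e l : ℕ} (hn : 0 < n) (hnk : n = k + 2 * e) (hl : 2 * l ≤ k) :
    ∑ j ∈ Finset.range (n / 2 + 1), gegCoeff ν (n - 2 * j) j * 2 ^ (n - 2 * j) * (-1) ^ j *
      (S * ((n - 2 * j)! * k ! / (4 ^ (e + k - j) * (e + k - j)! * poch δ (e + k - j))) *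
        ((e + k - j).choose l * (e + k - j - l).choose (k - 2 * l))) =
    S * (δ + n - 1) * k ! / (2 ^ k * l ! * (k - 2 * l)! * (e + l)!) *
      ∑ j ∈ Finset.range (e + l + 1), (-1) ^ j * ((e + l).choose j : ℝ) *
        (poch δ (n - j - 1) / poch δ (e + k - j)) := by
  have hsub : Finset.range (e + l + 1) ⊆ Finset.range (n / 2 + 1) := by
    intro j; simp; omega
  rw [← Finset.sum_subset hsub, Finset.mul_sum]
  · refine Finset.sum_congr rfl fun j hj => ?_
    have hj' : j ≤ e + l := by have := Finset.mem_range.mp hj; omega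
    -- The two summands of `gegCoeff` merge: (δ + n - j - 1) + j = δ + n - 1 does not depend on j.
    have h1 : gegCoeff ν (n - 2 * j) j = poch δ (n - j - 1) * (δ + n - 1) / ((n - 2 * j)! * j !) := by
      rw [gegCoeff, hν, show n - 2 * j + j = (n - j - 1) + 1 by omega, poch_succ,
        show n - j - 1 + 1 - 1 = n - j - 1 by omega,
        show n - j - 1 = n - (j + 1) by omega, Nat.cast_sub (by omega)]
      push_cast
      ring
    have h2 : (((e + k - j).choose l : ℕ) : ℝ) * ((e + k - j - l).choose (k - 2 * l) : ℕ) =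
        (e + k - j)! / (l ! * (k - 2 * l)! * (e + l - j)!) := by
      rw [Nat.cast_choose ℝ (show l ≤ e + k - j by omega),
        Nat.cast_choose ℝ (show k - 2 * l ≤ e + k - j - l by omega),
        show e + k - j - l - (k - 2 * l) = e + l - j by omega]
      have : ((e + k - j - l)! : ℝ) ≠ 0 := by positivity
      field_simp
    have h3 : ((e + l).choose j : ℝ) = (e + l)! / (j ! * (e + l - j)!) := Nat.cast_choose ℝ hj'
    have h4 : (4 : ℝ) ^ (e + k - j) = 2 ^ (n - 2 * j) * 2 ^ k := by
      rw [show (4 : ℝ) = 2 ^ 2 by norm_num, ← pow_mul, ← pow_add]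
      congr 1; omega
    have h5 := (poch_pos hδ (e + k - j)).ne'
    rw [h1, h2, h3, h4]
    have : ((e + l)! : ℝ) ≠ 0 := by positivity
    have : ((e + k - j)! : ℝ) ≠ 0 := by positivity
    have : ((n - 2 * j)! : ℝ) ≠ 0 := by positivity
    field_simp
  · intro j hj hj'
    have h1 : e + l < j := by simpa using hj'
    have h2 : j ≤ n / 2 := by have := Finset.mem_range.mp hj; omega
    rw [Nat.choose_eq_zero_of_lt (show e + k - j - l < k - 2 * l by omega)]
    simp

theorem integral_gegPoly_mul_pow (ν : ℝ) (μ ω : E) (n k : ℕ) :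
    ∫ ξ : Metric.sphere (0 : E) 1, gegPoly ν n (inner ℝ μ (ξ : E)) * (inner ℝ ω (ξ : E)) ^ k
      ∂(volume : Measure E).toSphere =
    ∑ j ∈ Finset.range (n / 2 + 1), gegCoeff ν (n - 2 * j) j * 2 ^ (n - 2 * j) * (-1) ^ j *
      sphereMoment μ ω (n - 2 * j) k := by
  simp_rw [gegPoly, Finset.sum_mul]
  rw [integral_finsetSum _ fun j _ => integrable_sphere (by fun_prop)]
  refine Finset.sum_congr rfl fun j _ => ?_
  rw [sphereMoment, ← integral_const_mul]
  refine integral_congr_ae (Filter.Eventually.of_forall fun ξ => ?_)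
  simp only [mul_pow]
  ring

theorem integral_gegPoly_mul_pow_eq_sum [Nontrivial E] {ν δ : ℝ} (hν : ν + 1 = δ)
    (hδ : δ = (Module.finrank ℝ E : ℝ) / 2) {μ ω : E} (hμ : ‖μ‖ = 1) (hω : ‖ω‖ = 1)
    {n k e : ℕ} (hn : 0 < n) (hnk : n = k + 2 * e) :
    ∫ ξ : Metric.sphere (0 : E) 1, gegPoly ν n (inner ℝ μ (ξ : E)) * (inner ℝ ω (ξ : E)) ^ k
      ∂(volume : Measure E).toSphere =
    ∑ l ∈ Finset.range (k / 2 + 1), (2 * inner ℝ ω μ) ^ (k - 2 * l) *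
      ((volume : Measure E).toSphere.real Set.univ *
        (δ + n - 1) * k ! / (2 ^ k * l ! * (k - 2 * l)! * (e + l)!) *
      ∑ j ∈ Finset.range (e + l + 1), (-1) ^ j * ((e + l).choose j : ℝ) *
        (poch δ (n - j - 1) / poch δ (e + k - j))) := by
  have hδ0 : 0 < δ := by
    rw [hδ]; exact div_pos (Nat.cast_pos.mpr Module.finrank_pos) two_pos
  rw [integral_gegPoly_mul_pow]
  have h1 : ∀ l ∈ Finset.range (k / 2 + 1), _ := fun l hl =>
    sum_gegCoeff_mul_sphereMoment_summand hν hδ0 ((volume : Measure E).toSphere.real Set.univ) hn hnk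
      (show 2 * l ≤ k by have := Finset.mem_range.mp hl; omega)
  refine Eq.trans ?_ (Finset.sum_congr rfl fun l hl => congrArg _ (h1 l hl))
  simp_rw [Finset.mul_sum]
  rw [Finset.sum_comm]
  refine Finset.sum_congr rfl fun j hj => ?_
  rw [sphereMoment_of_even hμ hω (h := e + k - j)
    (by have := Finset.mem_range.mp hj; omega), ← hδ, Finset.mul_sum, Finset.mul_sum]
  refine Finset.sum_congr rfl fun l _ => ?_
  ring

/-- For n - k = 2e the quotient of rising factorials is a polynomial of degree e - 1 in j, killed by
a difference of order e + l. For n - k odd all moments involved have odd total degree. -/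
theorem integral_gegPoly_mul_pow_eq_zero [Nontrivial E] {ν : ℝ}
    (hν : ν + 1 = (Module.finrank ℝ E : ℝ) / 2) {μ ω : E} (hμ : ‖μ‖ = 1) (hω : ‖ω‖ = 1)
    {n k : ℕ} (hkn : k < n) :
    ∫ ξ : Metric.sphere (0 : E) 1, gegPoly ν n (inner ℝ μ (ξ : E)) * (inner ℝ ω (ξ : E)) ^ k
      ∂(volume : Measure E).toSphere = 0 := by
  rcases Nat.even_or_odd (n - k) with ⟨e, he⟩ | ⟨e, he⟩
  · rw [integral_gegPoly_mul_pow_eq_sum hν rfl hμ hω (by omega) (show n = k + 2 * e by omega)]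
    refine Finset.sum_eq_zero fun l hl => ?_
    rw [Finset.mem_range] at hl
    set δ : ℝ := (Module.finrank ℝ E : ℝ) / 2
    have hδ0 : 0 < δ := div_pos (Nat.cast_pos.mpr Module.finrank_pos) two_pos
    have h1 := sum_alternating_choose_poch_eq_zero (e + l) (e - 1) (by omega) (δ + (e + k : ℕ))
    rw [Finset.sum_congr rfl fun j hj => ?_, h1]
    · ring
    · rw [Finset.mem_range] at hj
      congr 1
      rw [show n - j - 1 = (e + k - j) + (e - 1) by omega, poch_add,
        mul_div_cancel_left₀ _ (poch_pos hδ0 _).ne', Nat.cast_sub (show j ≤ e + k by omega)]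
      ring_nf
  · rw [integral_gegPoly_mul_pow]
    refine Finset.sum_eq_zero fun j hj => ?_
    rw [Finset.mem_range] at hj
    rw [sphereMoment_eq_zero_of_odd, mul_zero]
    rw [Nat.odd_iff]
    omega

theorem gegPoly_zero (ν t : ℝ) : gegPoly ν 0 t = 1 := by
  simp [gegPoly, gegCoeff, poch_zero]

/-- For e = 0 the quotient of rising factorials is 1/(δ + n - 1 - j), and the partial fraction
identity rebuilds the coefficients of Č_n, sign included. -/
theorem integral_gegPoly_mul_pow_self [Nontrivial E] {ν δ : ℝ} (hν : ν + 1 = δ)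
    (hδ : δ = (Module.finrank ℝ E : ℝ) / 2) {μ ω : E} (hμ : ‖μ‖ = 1) (hω : ‖ω‖ = 1) (n : ℕ) :
    ∫ ξ : Metric.sphere (0 : E) 1, gegPoly ν n (inner ℝ μ (ξ : E)) * (inner ℝ ω (ξ : E)) ^ n
      ∂(volume : Measure E).toSphere =
    (volume : Measure E).toSphere.real Set.univ * n ! / (2 ^ n * poch δ n) *
      gegPoly ν n (inner ℝ ω μ) := by
  have hδ0 : 0 < δ := by
    rw [hδ]; exact div_pos (Nat.cast_pos.mpr Module.finrank_pos) two_pos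
  rcases Nat.eq_zero_or_pos n with rfl | hn
  · simp [gegPoly_zero, poch_zero]
  rw [integral_gegPoly_mul_pow_eq_sum hν hδ hμ hω hn (show n = n + 2 * 0 by omega), gegPoly,
    Finset.mul_sum]
  refine Finset.sum_congr rfl fun l hl => ?_
  rw [Finset.mem_range] at hl
  have hnd : ∀ i : ℕ, i ≤ l → δ + n - 1 - i ≠ 0 := fun i hi => by
    have : ((i : ℝ) + 1) ≤ n := by exact_mod_cast (show i + 1 ≤ n by omega)
    linarith
  have h1 := sum_alternating_choose_inv l (δ + n - 1) hnd
  have h2 := prod_range_mul_poch δ n (l + 1) (by omega)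
  have hP : ∏ i ∈ Finset.range (l + 1), (δ + n - 1 - (i : ℝ)) ≠ 0 :=
    Finset.prod_ne_zero_iff.mpr fun i hi => hnd i (by have := Finset.mem_range.mp hi; omega)
  have h3 : ∀ j ∈ Finset.range (0 + l + 1), (-1 : ℝ) ^ j * ((0 + l).choose j : ℝ) *
      (poch δ (n - j - 1) / poch δ (0 + n - j)) =
      (-1) ^ j * (l.choose j : ℝ) * (1 / (δ + n - 1 - j)) := fun j hj => by
    rw [Finset.mem_range] at hj
    have hc : poch δ (n - j) = poch δ (n - j - 1) * (δ + n - 1 - j) := by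
      have hcast : ((n - j - 1 : ℕ) : ℝ) = n - j - 1 := by
        rw [Nat.sub_sub, Nat.cast_sub (by omega)]; push_cast; ring
      rw [show n - j = (n - j - 1) + 1 by omega, poch_succ, Nat.add_sub_cancel, hcast]
      ring
    have := (poch_pos hδ0 (n - j - 1)).ne'
    rw [zero_add, zero_add, hc, div_mul_eq_div_div, div_self this]
  rw [Finset.sum_congr rfl h3, zero_add, h1]
  have h4 : gegCoeff ν (n - 2 * l) l =
      poch δ (n - (l + 1)) * (δ + n - 1) / ((n - 2 * l)! * l !) := by
    rw [gegCoeff, hν, show n - 2 * l + l = (n - (l + 1)) + 1 by omega, poch_succ,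
      show n - (l + 1) + 1 - 1 = n - (l + 1) by omega, Nat.cast_sub (by omega)]
    push_cast
    ring
  rw [h4, ← h2]
  have := (poch_pos hδ0 (n - (l + 1))).ne'
  have : ((n - 2 * l)! : ℝ) ≠ 0 := by positivity
  field_simp

theorem gegCoeff_self_zero {ν δ : ℝ} (hν : ν + 1 = δ) (n : ℕ) :
    gegCoeff ν n 0 = poch δ n / n ! := by
  simp [gegCoeff, hν]

/-- Expand the factor of lower degree: only its leading term, and only for m = n, is not orthogonal
to the other factor. Its coefficient 2^n (δ)_n/n! cancels the constant of
`integral_gegPoly_mul_pow_self`. -/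
theorem integral_gegPoly_mul_gegPoly_of_le [Nontrivial E] {ν : ℝ}
    (hν : ν + 1 = (Module.finrank ℝ E : ℝ) / 2) {μ ω : E} (hμ : ‖μ‖ = 1) (hω : ‖ω‖ = 1)
    {m n : ℕ} (hmn : m ≤ n) :
    ∫ ξ : Metric.sphere (0 : E) 1, gegPoly ν n (inner ℝ μ (ξ : E)) * gegPoly ν m (inner ℝ ω (ξ : E))
      ∂(volume : Measure E).toSphere =
    if m = n then (volume : Measure E).toSphere.real Set.univ * gegPoly ν n (inner ℝ ω μ) else 0 := by
  have h1 : ∀ ξ : Metric.sphere (0 : E) 1,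
      gegPoly ν n (inner ℝ μ (ξ : E)) * gegPoly ν m (inner ℝ ω (ξ : E)) =
      ∑ j ∈ Finset.range (m / 2 + 1), (gegCoeff ν (m - 2 * j) j * 2 ^ (m - 2 * j) * (-1) ^ j) *
        (gegPoly ν n (inner ℝ μ (ξ : E)) * (inner ℝ ω (ξ : E)) ^ (m - 2 * j)) := fun ξ => by
    conv_lhs => rw [gegPoly.eq_1 ν m]
    rw [Finset.mul_sum]
    refine Finset.sum_congr rfl fun j _ => ?_
    rw [mul_pow]; ring
  simp_rw [h1]
  have hint : ∀ k : ℕ, Integrable (fun ξ : Metric.sphere (0 : E) 1 =>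
      gegPoly ν n (inner ℝ μ (ξ : E)) * (inner ℝ ω (ξ : E)) ^ k) (volume : Measure E).toSphere :=
    fun k => integrable_sphere ((continuous_gegPoly_inner ν n μ).mul (by fun_prop))
  rw [integral_finsetSum _ fun j _ => (hint _).const_mul _]
  simp_rw [integral_const_mul]
  split_ifs with hmn'
  · subst hmn'
    rw [Finset.sum_eq_single 0]
    · rw [mul_zero, Nat.sub_zero, integral_gegPoly_mul_pow_self hν rfl hμ hω,
        gegCoeff_self_zero hν]
      have hδ0 : 0 < (Module.finrank ℝ E : ℝ) / 2 :=
        div_pos (Nat.cast_pos.mpr Module.finrank_pos) two_pos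
      have := (poch_pos hδ0 m).ne'
      field_simp
    · intro j hj hj0
      rw [Finset.mem_range] at hj
      rw [integral_gegPoly_mul_pow_eq_zero hν hμ hω (by omega), mul_zero]
    · simp
  · refine Finset.sum_eq_zero fun j _ => ?_
    rw [integral_gegPoly_mul_pow_eq_zero hν hμ hω (by omega), mul_zero]

/-- The reproducing property of the normalized Gegenbauer polynomials on the unit sphere. -/
theorem integral_gegPoly_mul_gegPoly [Nontrivial E] {ν : ℝ}
    (hν : ν + 1 = (Module.finrank ℝ E : ℝ) / 2) {μ ω : E} (hμ : ‖μ‖ = 1) (hω : ‖ω‖ = 1) (m n : ℕ) :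
    ∫ ξ : Metric.sphere (0 : E) 1, gegPoly ν m (inner ℝ ω (ξ : E)) * gegPoly ν n (inner ℝ μ (ξ : E))
      ∂(volume : Measure E).toSphere =
    if m = n then (volume : Measure E).toSphere.real Set.univ * gegPoly ν n (inner ℝ ω μ) else 0 := by
  rcases le_total m n with h | h
  · simp_rw [mul_comm (gegPoly ν m _)]
    exact integral_gegPoly_mul_gegPoly_of_le hν hμ hω h
  · rw [integral_gegPoly_mul_gegPoly_of_le hν hω hμ h, real_inner_comm]
    by_cases hmn : m = n
    · subst hmn; rfl
    · rw [if_neg hmn, if_neg (Ne.symm hmn)]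

end Sphere

/-! ### Uniform bounds for the series of 𝓘 -/

/-- Restrict Euler's integral to x > y, where x^s ≥ y^s. -/
theorem rpow_le_exp_mul_Gamma {y s : ℝ} (hy : 0 < y) (hs : 0 ≤ s) :
    y ^ s ≤ Real.exp y * Real.Gamma (s + 1) := by
  have h1 := Real.GammaIntegral_convergent (show 0 < s + 1 by linarith)
  have h2 : ∫ x in Set.Ioi y, y ^ s * Real.exp (-x) ≤ Real.Gamma (s + 1) := by
    rw [Real.Gamma_eq_integral (by linarith)]
    calc ∫ x in Set.Ioi y, y ^ s * Real.exp (-x)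
        ≤ ∫ x in Set.Ioi y, Real.exp (-x) * x ^ (s + 1 - 1) := by
          refine setIntegral_mono_on ((integrableOn_exp_neg_Ioi y).const_mul _)
            (h1.mono_set (Set.Ioi_subset_Ioi hy.le)) measurableSet_Ioi fun x hx => ?_
          rw [add_sub_cancel_right, mul_comm]
          have : y ≤ x := (Set.mem_Ioi.mp hx).le
          gcongr
      _ ≤ ∫ x in Set.Ioi 0, Real.exp (-x) * x ^ (s + 1 - 1) := by
          refine setIntegral_mono_set h1 ?_ (Set.Ioi_subset_Ioi hy.le).eventuallyLE
          filter_upwards [ae_restrict_mem measurableSet_Ioi] with x hx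
          have : 0 < x := hx
          simp only [Pi.zero_apply]
          positivity
  rw [integral_const_mul, integral_exp_neg_Ioi] at h2
  calc y ^ s = Real.exp y * (y ^ s * Real.exp (-y)) := by
        rw [mul_left_comm, ← Real.exp_add]; simp
    _ ≤ _ := by gcongr

theorem inv_Gamma_le {y s : ℝ} (hy : 0 < y) (hs : -1 < s) :
    (Real.Gamma (s + 1))⁻¹ ≤ (s + 1) * Real.exp y * y ^ (-(s + 1)) := by
  have h1 := rpow_le_exp_mul_Gamma hy (show 0 ≤ s + 1 by linarith)
  rw [Real.Gamma_add_one (by linarith)] at h1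
  have hG : 0 < Real.Gamma (s + 1) := Real.Gamma_pos_of_pos (by linarith)
  rw [Real.rpow_neg hy.le, inv_eq_one_div, ← div_eq_mul_inv, div_le_div_iff₀ hG (by positivity)]
  linarith

/-- `inv_Gamma_le` has a free parameter y: y ≥ 2X absorbs X^k together with the 2^k that bounds k +
1, while the remaining y^(-β) is kept to offset the prefactor (w/2)^(bm). -/
theorem besselTerm_le {α₀ β X y : ℝ} (hα₀ : -1 < α₀) (hβ : 0 ≤ β) (hX : 0 ≤ X) (hy : 1 ≤ y)
    (hXy : 2 * X ≤ y) (k : ℕ) :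
    X ^ (2 * k) / (k ! * Real.Gamma (β + α₀ + k + 1)) ≤
      (β + α₀ + 2) * Real.exp y * y ^ (-β) * (X ^ k / k !) := by
  have hk0 : (0 : ℝ) ≤ k := k.cast_nonneg
  have hy0 : 0 < y := by linarith
  have h1 := inv_Gamma_le hy0 (show -1 < β + α₀ + k by linarith)
  have h2 : y ^ (-(β + α₀ + k + 1)) ≤ y ^ (-β) * (y ^ k)⁻¹ := by
    rw [← Real.rpow_natCast y k, ← Real.rpow_neg hy0.le, ← Real.rpow_add hy0]
    exact Real.rpow_le_rpow_of_exponent_le hy (by linarith)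
  have h3 : β + α₀ + k + 1 ≤ (β + α₀ + 2) * 2 ^ k := by
    have : (k : ℝ) + 1 ≤ 2 ^ k := by
      have := Nat.lt_two_pow_self (n := k)
      exact_mod_cast this
    nlinarith
  have h4 : X ^ (2 * k) * (y ^ k)⁻¹ * 2 ^ k ≤ X ^ k := by
    rw [two_mul, pow_add, ← div_eq_mul_inv, div_mul_eq_mul_div, div_le_iff₀ (by positivity), mul_assoc,
      ← mul_pow, mul_comm X 2]
    gcongr
  have h5 : 0 < β + α₀ + 2 := by linarith
  calc X ^ (2 * k) / (k ! * Real.Gamma (β + α₀ + k + 1))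
      = X ^ (2 * k) / k ! * (Real.Gamma (β + α₀ + k + 1))⁻¹ := by
        rw [div_mul_eq_div_div, div_eq_mul_inv]
    _ ≤ X ^ (2 * k) / k ! * (((β + α₀ + 2) * 2 ^ k) * Real.exp y * (y ^ (-β) * (y ^ k)⁻¹)) := by
        have h6 : 0 ≤ β + α₀ + k + 1 := by linarith
        refine mul_le_mul_of_nonneg_left (h1.trans ?_) (by positivity)
        gcongr
    _ = (β + α₀ + 2) * Real.exp y * y ^ (-β) * ((X ^ (2 * k) * (y ^ k)⁻¹ * 2 ^ k) / k !) := by ring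
    _ ≤ _ := by gcongr

theorem hasSum_pow_div_factorial (x : ℝ) : HasSum (fun k : ℕ => x ^ k / (k ! : ℝ)) (Real.exp x) := by
  rw [Real.exp_eq_exp_ℝ]
  exact NormedSpace.expSeries_div_hasSum_exp x

theorem norm_normBesselI_term {α : ℝ} (hα : -1 < α) (w : ℂ) (k : ℕ) :
    ‖(w / 2) ^ (2 * k) / ((k ! : ℂ) * (Real.Gamma (α + k + 1) : ℂ))‖ =
      ‖w / 2‖ ^ (2 * k) / (k ! * Real.Gamma (α + k + 1)) := by
  have : 0 < Real.Gamma (α + k + 1) :=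
    Real.Gamma_pos_of_pos (by have : (0 : ℝ) ≤ k := k.cast_nonneg
                              linarith)
  rw [norm_div, norm_pow, norm_mul, Complex.norm_natCast, Complex.norm_real,
    Real.norm_of_nonneg this.le]

theorem summable_besselTerm {α : ℝ} (hα : -1 < α) {X : ℝ} (hX : 0 ≤ X) :
    Summable (fun k : ℕ => X ^ (2 * k) / (k ! * Real.Gamma (α + k + 1))) := by
  refine Summable.of_nonneg_of_le (fun k => ?_) (fun k => ?_)
    ((hasSum_pow_div_factorial X).summable.mul_left ((0 + α + 2) * Real.exp (1 + 2 * X) *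
      (1 + 2 * X) ^ (-(0 : ℝ))))
  · have : 0 < Real.Gamma (α + k + 1) :=
      Real.Gamma_pos_of_pos (by have : (0 : ℝ) ≤ k := k.cast_nonneg
                                linarith)
    positivity
  · have := besselTerm_le hα le_rfl hX (show 1 ≤ 1 + 2 * X by linarith) (by linarith) k
    rwa [zero_add] at this ⊢

theorem norm_normBesselI_le {α₀ β y : ℝ} (hα₀ : -1 < α₀) (hβ : 0 ≤ β) (w : ℂ) (hy : 1 ≤ y)
    (hwy : 2 * ‖w / 2‖ ≤ y) :
    ‖normBesselI (β + α₀) w‖ ≤ (β + α₀ + 2) * Real.exp y * y ^ (-β) * Real.exp ‖w / 2‖ := by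
  refine tsum_of_norm_bounded ((hasSum_pow_div_factorial ‖w / 2‖).mul_left _) fun k => ?_
  rw [norm_normBesselI_term (by linarith)]
  exact besselTerm_le hα₀ hβ (norm_nonneg _) hy hwy k

/-- A bound on the terms of the series for `𝓘(b, ν, w, t)`, uniform in `t ∈ [-1, 1]`. -/
theorem exists_norm_scriptITerm_le {b ν : ℝ} (hb : 0 < b) (hν : -1 < ν) (hbν : -1 < b * ν) :
    ∃ (c : ℕ → ℝ) (L : ℝ), (∀ m, 0 ≤ c m) ∧ Summable c ∧ 0 ≤ L ∧
      ∀ (w : ℂ) (t : ℝ) (m : ℕ), |t| ≤ 1 → ‖scriptITerm b ν w t m‖ ≤ c m * Real.exp (L * ‖w‖) := by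
  obtain ⟨C, hC, hCb⟩ := exists_abs_gegPoly_le hν
  -- With y = 1 + ℓX, the 2 ensures 2X ≤ y and the 8^(1/b) ensures (X/y)^(bm) ≤ 8^(-m). Against the
  -- growth 4^m of Č_m this leaves 2^(-m).
  set ℓ : ℝ := 2 + 8 ^ (1 / b) with hℓ
  have h80 : (0 : ℝ) < 8 ^ (1 / b) := by positivity
  refine ⟨fun m => C * ((b * m + b * ν + 2) * (1 / 2) ^ m) * Real.exp 1, (ℓ + 1) / 2, fun m => ?_,
    ?_, by positivity, ?_⟩
  · have : 0 ≤ b * m + b * ν + 2 := by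
      have : 0 ≤ b * m := by positivity
      linarith
    positivity
  · refine (Summable.mul_left _ ?_).mul_right _
    have h1 : Summable fun m : ℕ => (m : ℝ) ^ 1 * (1 / 2) ^ m :=
      summable_pow_mul_geometric_of_norm_lt_one 1 (by norm_num [abs_of_pos])
    have h2 : Summable fun m : ℕ => (1 / 2 : ℝ) ^ m := summable_geometric_two
    refine ((h1.mul_left b).add (h2.mul_left (b * ν + 2))).congr fun m => ?_
    ring
  · intro w t m ht
    set X := ‖w / 2‖ with hX
    have hX0 : 0 ≤ X := norm_nonneg _
    have hwX : ‖w‖ = 2 * X := by rw [hX, norm_div]; simp; ring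
    have hβ : 0 ≤ b * m := by positivity
    set y := 1 + ℓ * X with hy
    have hy1 : 1 ≤ y := by
      have : 0 ≤ ℓ * X := by positivity
      linarith
    have hyX : 8 ^ (1 / b) * X ≤ y := by nlinarith
    have h1 := norm_normBesselI_le (y := y) hbν hβ w hy1 (by nlinarith)
    have h2 : X ^ (b * m) * y ^ (-(b * m)) ≤ (1 / 8) ^ m := by
      have hXy : X / y ≤ (1 / 8) ^ (1 / b) := by
        rw [Real.div_rpow (by norm_num) (by norm_num), Real.one_rpow,
          div_le_div_iff₀ (by linarith) h80]
        linarith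
      rw [Real.rpow_neg (by linarith), ← div_eq_mul_inv, ← Real.div_rpow hX0 (by linarith)]
      calc (X / y) ^ (b * m) ≤ ((1 / 8 : ℝ) ^ (1 / b)) ^ (b * m) :=
            Real.rpow_le_rpow (div_nonneg hX0 (by linarith)) hXy hβ
        _ = (1 / 8) ^ m := by
            rw [← Real.rpow_mul (by norm_num), ← Real.rpow_natCast]
            congr 1
            field_simp
    rw [scriptITerm, norm_mul, norm_mul, Complex.norm_cpow_real, Complex.norm_real,
      normGegenbauer_eq_gegPoly hν, Real.norm_eq_abs, mul_add b]
    have h5 : 0 < b * m + b * ν + 2 := by linarith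
    calc X ^ (b * m) * ‖normBesselI (b * m + b * ν) w‖ * |gegPoly ν m t|
        ≤ X ^ (b * m) * ((b * m + b * ν + 2) * Real.exp y * y ^ (-(b * m)) * Real.exp X) *
          (C * 4 ^ m) := by
          gcongr
          exact hCb m t ht
      _ = (X ^ (b * m) * y ^ (-(b * m))) * ((b * m + b * ν + 2) * (C * 4 ^ m)) *
          (Real.exp y * Real.exp X) := by ring
      _ ≤ (1 / 8) ^ m * ((b * m + b * ν + 2) * (C * 4 ^ m)) * (Real.exp y * Real.exp X) := by
          gcongr
      _ = C * ((b * m + b * ν + 2) * ((1 / 8) ^ m * 4 ^ m)) * (Real.exp y * Real.exp X) := by ring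
      _ = _ := by
          rw [← mul_pow, ← Real.exp_add, mul_assoc (C * _) (Real.exp 1), ← Real.exp_add, hwX, hy]
          norm_num
          left
          ring

/-! ### Weber's second exponential integral -/

/-- The entire function `∑ₖ y ^ k / (k! Γ(α + k + 1))` on the real line. -/
def besselE (α y : ℝ) : ℝ := ∑' k : ℕ, y ^ k / (k ! * Real.Gamma (α + k + 1))

theorem summable_norm_besselE {α : ℝ} (hα : -1 < α) (y : ℝ) :
    Summable (fun k : ℕ => ‖y ^ k / (k ! * Real.Gamma (α + k + 1))‖) := by
  refine (summable_besselTerm hα (Real.sqrt_nonneg |y|)).congr fun k => ?_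
  have : 0 < Real.Gamma (α + k + 1) :=
    Real.Gamma_pos_of_pos (by have : (0 : ℝ) ≤ k := k.cast_nonneg
                              linarith)
  rw [pow_mul, Real.sq_sqrt (abs_nonneg _), norm_div, norm_pow, Real.norm_eq_abs y,
    Real.norm_of_nonneg (r := _ * _) (by positivity)]

/-- Both the imaginary arguments of the kernels and the real argument of the result have real
squares, so the Bessel factors become real. -/
theorem normBesselI_eq_besselE {w : ℂ} {y : ℝ} (h : (w / 2) ^ 2 = y) (α : ℝ) :
    normBesselI α w = besselE α y := by
  rw [normBesselI, besselE, Complex.ofReal_tsum]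
  congr 1
  funext k
  rw [pow_mul, h]
  push_cast
  rfl

/-- A Chu–Vandermonde identity. Pascal's rule splits the sum, and the shifted half is l times the
same sum at (l - 1, α + 1); hence the induction is over all l and α. -/
theorem sum_choose_mul_descFactorial_div_Gamma (k : ℕ) : ∀ (l : ℕ) {α : ℝ} (_ : -1 < α),
    ∑ i ∈ Finset.range (k + 1), (k.choose i : ℝ) * (l.descFactorial i / Real.Gamma (α + i + 1)) =
      Real.Gamma (α + k + l + 1) / (Real.Gamma (α + k + 1) * Real.Gamma (α + l + 1)) := by
  induction k with
  | zero =>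
    intro l α hα
    have : 0 < Real.Gamma (α + l + 1) :=
      Real.Gamma_pos_of_pos (by have : (0 : ℝ) ≤ l := l.cast_nonneg
                                linarith)
    simp
    field_simp
  | succ k ih =>
    intro l α hα
    have hk : (0 : ℝ) ≤ k := k.cast_nonneg
    have hl : (0 : ℝ) ≤ l := l.cast_nonneg
    set f : ℕ → ℝ := fun i => l.descFactorial i / Real.Gamma (α + i + 1) with hf
    have h1 : ∑ i ∈ Finset.range (k + 2), ((k + 1).choose i : ℝ) * f i =
        ∑ i ∈ Finset.range (k + 1), (k.choose i : ℝ) * f i +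
        ∑ i ∈ Finset.range (k + 1), (k.choose i : ℝ) * f (i + 1) := by
      rw [Finset.sum_range_succ', Finset.sum_range_succ' (fun i => (k.choose i : ℝ) * f i)]
      have : ∑ i ∈ Finset.range k, (k.choose (i + 1) : ℝ) * f (i + 1) =
          ∑ i ∈ Finset.range (k + 1), (k.choose (i + 1) : ℝ) * f (i + 1) := by
        rw [Finset.sum_range_succ]; simp
      rw [this, add_right_comm, ← Finset.sum_add_distrib]
      simp only [Nat.choose_succ_succ, Nat.cast_add, Nat.choose_zero_right]
      congr 1
      refine Finset.sum_congr rfl fun i _ => ?_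
      ring
    have h2 : ∑ i ∈ Finset.range (k + 1), (k.choose i : ℝ) * f (i + 1) =
        l * (Real.Gamma (α + k + l + 1) / (Real.Gamma (α + k + 2) * Real.Gamma (α + l + 1))) := by
      rcases l with _ | l
      · simp [hf]
      · have h3 := ih l (α := α + 1) (by linarith)
        rw [show α + 1 + k + l + 1 = α + k + (l + 1 : ℕ) + 1 by push_cast; ring,
          show α + 1 + k + 1 = α + k + 2 by ring,
          show α + 1 + l + 1 = α + (l + 1 : ℕ) + 1 by push_cast; ring] at h3
        rw [← h3, Finset.mul_sum]
        refine Finset.sum_congr rfl fun i _ => ?_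
        simp only [hf, Nat.succ_descFactorial_succ]
        rw [show α + (i + 1 : ℕ) + 1 = α + 1 + i + 1 by push_cast; ring]
        push_cast
        ring
    rw [h1, h2, ih l hα]
    have g1 : 0 < Real.Gamma (α + k + 1) := Real.Gamma_pos_of_pos (by linarith)
    have g2 : 0 < Real.Gamma (α + l + 1) := Real.Gamma_pos_of_pos (by linarith)
    have e1 : Real.Gamma (α + k + 2) = (α + k + 1) * Real.Gamma (α + k + 1) := by
      rw [← Real.Gamma_add_one (by linarith)]; ring_nf
    have e2 : Real.Gamma (α + (k + 1 : ℕ) + l + 1) = (α + k + l + 1) * Real.Gamma (α + k + l + 1) := by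
      rw [← Real.Gamma_add_one (by linarith)]; push_cast; ring_nf
    have e3 : α + (k + 1 : ℕ) + 1 = α + k + 2 := by push_cast; ring
    have h0 : α + k + 1 ≠ 0 := by linarith
    rw [e2, e3, e1]
    field_simp
    ring

theorem sum_inv_factorial_mul_Gamma {α : ℝ} (hα : -1 < α) (k l : ℕ) :
    ∑ i ∈ Finset.range (min k l + 1),
      1 / ((i ! : ℝ) * (k - i)! * (l - i)! * Real.Gamma (α + i + 1)) =
    Real.Gamma (α + k + l + 1) /
      (k ! * l ! * Real.Gamma (α + k + 1) * Real.Gamma (α + l + 1)) := by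
  have h1 := sum_choose_mul_descFactorial_div_Gamma k l hα
  have hsub : Finset.range (min k l + 1) ⊆ Finset.range (k + 1) := by
    intro i; simp; omega
  rw [← Finset.sum_subset hsub] at h1
  · have h2 : Real.Gamma (α + k + l + 1) /
        (k ! * l ! * Real.Gamma (α + k + 1) * Real.Gamma (α + l + 1)) = 1 / (k ! * l !) *
        (Real.Gamma (α + k + l + 1) / (Real.Gamma (α + k + 1) * Real.Gamma (α + l + 1))) := by
      ring
    rw [h2, ← h1, Finset.mul_sum]
    refine Finset.sum_congr rfl fun i hi => ?_
    rw [Finset.mem_range] at hi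
    have h3 : ((l - i)! : ℝ) * l.descFactorial i = l ! := by
      exact_mod_cast Nat.factorial_mul_descFactorial (show i ≤ l by omega)
    rw [Nat.cast_choose ℝ (show i ≤ k by omega), ← h3]
    have h4 : (l.descFactorial i : ℝ) ≠ 0 := by
      have : (l ! : ℝ) ≠ 0 := by positivity
      rw [← h3] at this
      exact (mul_ne_zero_iff.mp this).2
    have : (k ! : ℝ) ≠ 0 := by positivity
    field_simp
  · intro i hi hi'
    rw [Finset.mem_range] at hi hi'
    rw [Nat.descFactorial_eq_zero_iff_lt.mpr (by omega)]
    simp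

/-- Summing a triple series along the fibres of `(i, p, q) ↦ (i + p, i + q)`. -/
theorem HasSum.along_diagonal_add {G : ℕ × ℕ × ℕ → ℝ} {S : ℝ} (h : HasSum G S) :
    HasSum (fun p : ℕ × ℕ => ∑ i ∈ Finset.range (min p.1 p.2 + 1), G (i, p.1 - i, p.2 - i)) S := by
  have h3 := h.tsum_fiberwise (fun q : ℕ × ℕ × ℕ => (q.1 + q.2.1, q.1 + q.2.2))
  refine h3.congr_fun fun p => ?_
  obtain ⟨k, l⟩ := p
  have hfib : ((fun q : ℕ × ℕ × ℕ => (q.1 + q.2.1, q.1 + q.2.2)) ⁻¹' {(k, l)}) =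
      ((Finset.range (min k l + 1)).image (fun i => (i, k - i, l - i)) : Finset (ℕ × ℕ × ℕ)) := by
    ext ⟨i, p, q⟩
    simp
    omega
  rw [hfib, Finset.tsum_subtype', Finset.sum_image fun i _ j _ hij => congrArg Prod.fst hij]

theorem HasSum.mul_of_summable_norm {ι κ : Type*} {f : ι → ℝ} {g : κ → ℝ} {a b : ℝ}
    (hf : HasSum f a) (hg : HasSum g b) (hf' : Summable fun i => ‖f i‖)
    (hg' : Summable fun i => ‖g i‖) : HasSum (fun p : ι × κ => f p.1 * g p.2) (a * b) :=
  hf.mul hg (summable_mul_of_summable_norm hf' hg')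

/-- The coefficient of `x ^ k y ^ l` in `e ^ (x + y) * besselE α (x * y)`. -/
def weberCoeff (α : ℝ) (k l : ℕ) : ℝ :=
  Real.Gamma (α + k + l + 1) / (k ! * l ! * Real.Gamma (α + k + 1) * Real.Gamma (α + l + 1))

/-- Multiply three absolutely convergent series and collect x^k y^l; the inner finite sum is the
Vandermonde identity. -/
theorem hasSum_exp_mul_besselE {α : ℝ} (hα : -1 < α) (x y : ℝ) :
    HasSum (fun p : ℕ × ℕ => x ^ p.1 * y ^ p.2 * weberCoeff α p.1 p.2)
      (Real.exp (x + y) * besselE α (x * y)) := by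
  have hs1 := fun x : ℝ => (Real.summable_pow_div_factorial x).norm
  have hs2 := summable_norm_besselE hα (x * y)
  have h1 := (hasSum_pow_div_factorial x).mul_of_summable_norm (hasSum_pow_div_factorial y)
    (hs1 x) (hs1 y)
  have hs3 := Summable.mul_norm (hs1 x) (hs1 y)
  have h2 := (hs2.of_norm.hasSum.mul_of_summable_norm h1 hs2 hs3).along_diagonal_add
  rw [Real.exp_add, mul_comm (Real.exp x * Real.exp y)]
  have h3 : (fun p : ℕ × ℕ => x ^ p.1 * y ^ p.2 * weberCoeff α p.1 p.2) =
      fun p : ℕ × ℕ => ∑ i ∈ Finset.range (min p.1 p.2 + 1),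
        (x * y) ^ i / (i ! * Real.Gamma (α + i + 1)) *
          (x ^ (p.1 - i) / (p.1 - i)! * (y ^ (p.2 - i) / (p.2 - i)!)) := by
    funext p
    rw [weberCoeff, ← sum_inv_factorial_mul_Gamma hα, Finset.mul_sum]
    refine Finset.sum_congr rfl fun i hi => ?_
    rw [Finset.mem_range] at hi
    have e1 : x ^ p.1 = x ^ i * x ^ (p.1 - i) := by rw [← pow_add]; congr 1; omega
    have e2 : y ^ p.2 = y ^ i * y ^ (p.2 - i) := by rw [← pow_add]; congr 1; omega
    rw [e1, e2, mul_pow]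
    field_simp
  rw [h3]
  exact h2

/-- A term of the double expansion of the integrand in Weber's integral. -/
def weberTerm (α R S t : ℝ) (p : ℕ × ℕ) (z : ℝ) : ℝ :=
  z ^ α * ((-(R * z)) ^ p.1 / (p.1 ! * Real.Gamma (α + p.1 + 1)) *
    ((-(S * z)) ^ p.2 / (p.2 ! * Real.Gamma (α + p.2 + 1)))) * Real.exp (-(t * z))

theorem weberTerm_eq {α : ℝ} (hα : -1 < α) (R S t : ℝ) (p : ℕ × ℕ) {z : ℝ} (hz : 0 < z) :
    weberTerm α R S t p z = ((-R) ^ p.1 * (-S) ^ p.2 * weberCoeff α p.1 p.2 /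
      Real.Gamma (α + p.1 + p.2 + 1)) * (z ^ (α + p.1 + p.2 + 1 - 1) * Real.exp (-(t * z))) := by
  have h1 : (0 : ℝ) ≤ p.1 := p.1.cast_nonneg
  have h2 : (0 : ℝ) ≤ p.2 := p.2.cast_nonneg
  rw [weberTerm, weberCoeff, add_sub_cancel_right, Real.rpow_add_natCast hz.ne',
    Real.rpow_add_natCast hz.ne', ← neg_mul, ← neg_mul, mul_pow, mul_pow]
  have := (Real.Gamma_pos_of_pos (show 0 < α + p.1 + p.2 + 1 by linarith)).ne'
  field_simp

theorem integrableOn_weberTerm {α t : ℝ} (hα : -1 < α) (R S : ℝ) (ht : 0 < t) (p : ℕ × ℕ) :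
    IntegrableOn (weberTerm α R S t p) (Set.Ioi 0) := by
  have h1 : (0 : ℝ) ≤ p.1 := p.1.cast_nonneg
  have h2 : (0 : ℝ) ≤ p.2 := p.2.cast_nonneg
  have h3 := integrableOn_rpow_mul_exp_neg_mul_rpow (p := 1) (s := α + p.1 + p.2 + 1 - 1) (b := t)
    (by linarith) one_pos ht
  have h4 : IntegrableOn (fun z : ℝ => z ^ (α + p.1 + p.2 + 1 - 1) * Real.exp (-(t * z)))
      (Set.Ioi 0) := by simpa using h3
  refine IntegrableOn.congr_fun ?_ (fun z hz => (weberTerm_eq hα R S t p hz).symm) measurableSet_Ioi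
  exact Integrable.const_mul h4 _

theorem integral_weberTerm {α t : ℝ} (hα : -1 < α) (R S : ℝ) (ht : 0 < t) (p : ℕ × ℕ) :
    ∫ z in Set.Ioi (0 : ℝ), weberTerm α R S t p z =
      (1 / t) ^ (α + 1) * ((-R / t) ^ p.1 * (-S / t) ^ p.2 * weberCoeff α p.1 p.2) := by
  have h1 : (0 : ℝ) ≤ p.1 := p.1.cast_nonneg
  have h2 : (0 : ℝ) ≤ p.2 := p.2.cast_nonneg
  have h3 : 0 < α + p.1 + p.2 + 1 := by linarith
  have hG := (Real.Gamma_pos_of_pos h3).ne'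
  rw [setIntegral_congr_fun measurableSet_Ioi (fun z hz => weberTerm_eq hα R S t p hz),
    integral_const_mul, Real.integral_rpow_mul_exp_neg_mul_Ioi h3 ht]
  have h4 : (1 / t) ^ (α + p.1 + p.2 + 1) = (1 / t) ^ (α + 1) * (1 / t) ^ p.1 * (1 / t) ^ p.2 := by
    rw [show α + p.1 + p.2 + 1 = α + 1 + p.1 + p.2 by ring,
      Real.rpow_add_natCast (by positivity), Real.rpow_add_natCast (by positivity)]
  rw [h4, div_eq_mul_one_div (-R) t, div_eq_mul_one_div (-S) t, mul_pow, mul_pow]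
  generalize Real.Gamma (α + p.1 + p.2 + 1) = G at hG
  field_simp

/-- Reversing the signs of R and S removes all cancellation, so the evaluation of the integrals also
proves summability of their norms. -/
theorem norm_weberTerm {α R S : ℝ} (hα : -1 < α) (hR : 0 ≤ R) (hS : 0 ≤ S) (t : ℝ) (p : ℕ × ℕ)
    {z : ℝ} (hz : 0 < z) :
    ‖weberTerm α R S t p z‖ = weberTerm α (-R) (-S) t p z := by
  have hG : ∀ k : ℕ, 0 < Real.Gamma (α + k + 1) := fun k =>
    Real.Gamma_pos_of_pos (by have : (0 : ℝ) ≤ k := k.cast_nonneg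
                              linarith)
  have := hG p.1
  have := hG p.2
  rw [weberTerm, weberTerm, norm_mul, norm_mul, norm_mul, norm_div, norm_div, norm_pow, norm_pow,
    norm_neg, norm_neg, neg_mul, neg_mul, neg_neg, neg_neg,
    Real.norm_of_nonneg (r := R * z) (by positivity), Real.norm_of_nonneg (r := S * z) (by positivity),
    Real.norm_of_nonneg (r := z ^ α) (by positivity), Real.norm_of_nonneg (Real.exp_pos _).le,
    Real.norm_of_nonneg (r := _ * Real.Gamma (α + p.1 + 1)) (by positivity),
    Real.norm_of_nonneg (r := _ * Real.Gamma (α + p.2 + 1)) (by positivity)]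

theorem tsum_weberTerm {α : ℝ} (hα : -1 < α) (R S t z : ℝ) :
    ∑' p, weberTerm α R S t p z =
      z ^ α * (besselE α (-(R * z)) * besselE α (-(S * z))) * Real.exp (-(t * z)) := by
  simp only [weberTerm]
  rw [tsum_mul_right, tsum_mul_left, besselE, besselE,
    tsum_mul_tsum_of_summable_norm (summable_norm_besselE hα _) (summable_norm_besselE hα _)]

/-- Weber's second exponential integral, for the normalized Bessel functions. -/
theorem integral_besselE_mul_besselE {α R S t : ℝ} (hα : -1 < α) (hR : 0 ≤ R) (hS : 0 ≤ S)
    (ht : 0 < t) :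
    ∫ z in Set.Ioi (0 : ℝ), z ^ α * (besselE α (-(R * z)) * besselE α (-(S * z))) *
      Real.exp (-(t * z)) =
    (1 / t) ^ (α + 1) * (Real.exp (-((R + S) / t)) * besselE α (R * S / t ^ 2)) := by
  have hsum := hasSum_integral_of_summable_integral_norm (μ := volume.restrict (Set.Ioi (0 : ℝ)))
    (F := weberTerm α R S t) (integrableOn_weberTerm hα R S ht) (by
      refine ((hasSum_exp_mul_besselE hα (R / t) (S / t)).mul_left
        ((1 / t) ^ (α + 1))).summable.congr fun p => ?_
      rw [setIntegral_congr_fun measurableSet_Ioi (fun z hz => norm_weberTerm hα hR hS t p hz),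
        integral_weberTerm hα _ _ ht, neg_neg, neg_neg])
  simp_rw [tsum_weberTerm hα, integral_weberTerm hα R S ht] at hsum
  have h1 := (hasSum_exp_mul_besselE hα (-R / t) (-S / t)).mul_left ((1 / t) ^ (α + 1))
  rw [show -((R + S) / t) = -R / t + -S / t by ring,
    show R * S / t ^ 2 = -R / t * (-S / t) by field_simp]
  exact hsum.unique h1

/-! ### The radial integrals -/

theorem measurable_tsum_of_summable {α F : Type*} [MeasurableSpace α] [NormedAddCommGroup F]
    [MeasurableSpace F] [BorelSpace F] [SecondCountableTopology F] {f : ℕ → α → F}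
    (hf : ∀ m, Measurable (f m)) (hs : ∀ x, Summable fun m => f m x) :
    Measurable fun x => ∑' m, f m x := by
  refine measurable_of_tendsto_metrizable (f := fun n x => ∑ m ∈ Finset.range n, f m x)
    (fun n => Finset.measurable_fun_sum _ fun m _ => hf m) ?_
  exact tendsto_pi_nhds.mpr fun x => (hs x).hasSum.tendsto_sum_nat

theorem measurable_normBesselI {α : ℝ} (hα : -1 < α) : Measurable (normBesselI α) := by
  refine measurable_tsum_of_summable (fun k => by fun_prop) fun w => Summable.of_norm ?_
  simp_rw [norm_normBesselI_term hα]
  exact summable_besselTerm hα (norm_nonneg _)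

theorem measurable_scriptITerm_radial {b ν : ℝ} {m : ℕ} (h : -1 < b * (m + ν)) :
    Measurable fun w : ℂ => (w / 2) ^ ((b * m : ℝ) : ℂ) * normBesselI (b * (m + ν)) w :=
  Measurable.mul (by fun_prop) (measurable_normBesselI h)

/-- The principal argument of -i is -π/2, so the phases e^{iπc/2} and e^{-iπc/2} cancel. A zero base
or exponent is separate. -/
theorem conj_cpow_mul_cpow_neg_I {X Y c : ℝ} (hX : 0 ≤ X) (hY : 0 ≤ Y) (hc : 0 ≤ c) :
    conj (((X : ℂ) * -I) ^ (c : ℂ)) * ((Y : ℂ) * -I) ^ (c : ℂ) = (((X * Y) ^ c : ℝ) : ℂ) := by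
  rcases hc.eq_or_lt with rfl | hc
  · simp
  have hc' : (c : ℂ) ≠ 0 := by exact_mod_cast hc.ne'
  rcases hX.eq_or_lt with rfl | hX
  · simp [Complex.zero_cpow hc', Real.zero_rpow hc.ne']
  rcases hY.eq_or_lt with rfl | hY
  · simp [Complex.zero_cpow hc', Real.zero_rpow hc.ne']
  have hI : (-I : ℂ) ≠ 0 := neg_ne_zero.mpr I_ne_zero
  have key : ∀ Z : ℝ, 0 < Z → ((Z : ℂ) * -I) ^ (c : ℂ) =
      cexp (((Real.log Z : ℝ) + (-(Real.pi / 2) * I)) * c) := fun Z hZ => by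
    rw [Complex.cpow_def_of_ne_zero (mul_ne_zero (by exact_mod_cast hZ.ne') hI),
      Complex.log_ofReal_mul hZ hI, Complex.log_neg_I]
  rw [key X hX, key Y hY, ← Complex.exp_conj, ← Complex.exp_add, Real.rpow_def_of_pos (by positivity),
    Real.log_mul hX.ne' hY.ne', Complex.ofReal_exp]
  congr 1
  simp [map_ofNat (starRingEnd ℂ) 2]
  ring

/-- The substitution z = ρ^a/a turns the heat weight into e^{-tz} and the Bessel arguments into
linear functions of z. -/
theorem integral_rpow_mul_comp_rpow_div {a : ℝ} (ha : 0 < a) (g : ℝ → ℝ) :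
    ∫ ρ in Set.Ioi (0 : ℝ), ρ ^ (a - 1) * g (ρ ^ a / a) = ∫ z in Set.Ioi (0 : ℝ), g z := by
  have h1 := integral_comp_rpow_Ioi_of_pos (g := fun y => g (a⁻¹ * y)) ha
  have h2 := integral_comp_mul_left_Ioi g 0 (inv_pos.mpr ha)
  rw [mul_zero, inv_inv] at h2
  rw [h2] at h1
  have h3 : ∫ ρ in Set.Ioi (0 : ℝ), (a * ρ ^ (a - 1)) • g (a⁻¹ * ρ ^ a) =
      a * ∫ ρ in Set.Ioi (0 : ℝ), ρ ^ (a - 1) * g (ρ ^ a / a) := by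
    rw [← integral_const_mul]
    congr 1
    funext ρ
    rw [smul_eq_mul, div_eq_inv_mul, mul_assoc]
  rw [h3, smul_eq_mul] at h1
  exact mul_left_cancel₀ ha.ne' h1

/-- The third argument of `𝓘` in the kernel `B_a(rω, ρη)`. -/
def kernelArg (a r ρ : ℝ) : ℂ := ((2 * (r * ρ) ^ (a / 2) : ℝ) : ℂ) / ((a : ℂ) * I)

theorem kernelArg_div_two (a r ρ : ℝ) :
    kernelArg a r ρ / 2 = (((r * ρ) ^ (a / 2) / a : ℝ) : ℂ) * -I := by
  rw [kernelArg, div_eq_mul_inv _ ((a : ℂ) * I), mul_inv, Complex.inv_I]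
  push_cast
  ring

theorem kernelArg_div_two_sq {a r ρ : ℝ} (hr : 0 ≤ r) (hρ : 0 ≤ ρ) :
    (kernelArg a r ρ / 2) ^ 2 = ((-(r ^ a / a * (ρ ^ a / a)) : ℝ) : ℂ) := by
  have h : ((r * ρ) ^ (a / 2)) ^ 2 = r ^ a * ρ ^ a := by
    rw [← Real.rpow_natCast, ← Real.rpow_mul (by positivity), ← Real.mul_rpow hr hρ]
    norm_num
  rw [kernelArg_div_two, mul_pow, neg_sq, I_sq, ← Complex.ofReal_pow, div_pow, h]
  push_cast
  ring

theorem norm_kernelArg {a r ρ : ℝ} (ha : 0 < a) (hr : 0 ≤ r) (hρ : 0 ≤ ρ) :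
    ‖kernelArg a r ρ‖ = 2 * r ^ (a / 2) / a * ρ ^ (a / 2) := by
  rw [kernelArg, norm_div, norm_mul, Complex.norm_I, mul_one, Complex.norm_real, Complex.norm_real,
    Real.norm_of_nonneg ha.le, Real.norm_of_nonneg (by positivity), Real.mul_rpow hr hρ]
  ring

theorem measurable_kernelArg (a r : ℝ) : Measurable (kernelArg a r) := by
  unfold kernelArg
  fun_prop

/-- The radial factor of the `m`-th term of the series for `B_a(rω, ρη)`. -/
def radialFactor (a ν r : ℝ) (m : ℕ) (ρ : ℝ) : ℂ :=
  (kernelArg a r ρ / 2) ^ ((2 / a * m : ℝ) : ℂ) * normBesselI (2 / a * (m + ν)) (kernelArg a r ρ)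

theorem scriptITerm_kernelArg {ν : ℝ} (hν : -1 < ν) (a r ρ τ : ℝ) (m : ℕ) :
    scriptITerm (2 / a) ν (kernelArg a r ρ) τ m = radialFactor a ν r m ρ * (gegPoly ν m τ : ℂ) := by
  rw [scriptITerm, radialFactor, normGegenbauer_eq_gegPoly hν]

theorem neg_one_lt_order {a ν : ℝ} (ha : 0 < a) (haν : -1 < 2 / a * ν) (m : ℕ) :
    -1 < 2 / a * (m + ν) := by
  have : 0 ≤ 2 / a * m := by positivity
  rw [mul_add]
  linarith

theorem measurable_radialFactor {a ν : ℝ} (ha : 0 < a) (haν : -1 < 2 / a * ν) (r : ℝ) (m : ℕ) :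
    Measurable (radialFactor a ν r m) :=
  (measurable_scriptITerm_radial (neg_one_lt_order ha haν m)).comp (measurable_kernelArg a r)

theorem conj_radialFactor_mul_radialFactor {a r s ρ : ℝ} (ha : 0 < a) (hr : 0 ≤ r) (hs : 0 ≤ s)
    (hρ : 0 ≤ ρ) (ν : ℝ) (m : ℕ) :
    conj (radialFactor a ν r m ρ) * radialFactor a ν s m ρ =
      (((r * s * ρ ^ 2) ^ m * (1 / a) ^ (2 * (2 / a * m)) *
        (besselE (2 / a * (m + ν)) (-(r ^ a / a * (ρ ^ a / a))) *
          besselE (2 / a * (m + ν)) (-(s ^ a / a * (ρ ^ a / a)))) : ℝ) : ℂ) := by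
  have h1 := conj_cpow_mul_cpow_neg_I (X := (r * ρ) ^ (a / 2) / a) (Y := (s * ρ) ^ (a / 2) / a)
    (c := 2 / a * m) (by positivity) (by positivity) (by positivity)
  have h2 : ((r * ρ) ^ (a / 2) / a * ((s * ρ) ^ (a / 2) / a)) ^ (2 / a * m) =
      (r * s * ρ ^ 2) ^ m * (1 / a) ^ (2 * (2 / a * m)) := by
    rw [show (r * ρ) ^ (a / 2) / a * ((s * ρ) ^ (a / 2) / a) =
        ((r * ρ) ^ (a / 2) * (s * ρ) ^ (a / 2)) * ((1 / a) ^ (2 : ℝ)) by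
          rw [Real.rpow_two]; field_simp,
      ← Real.mul_rpow (by positivity) (by positivity),
      Real.mul_rpow (by positivity) (by positivity), ← Real.rpow_mul (by positivity),
      ← Real.rpow_mul (by positivity), show a / 2 * (2 / a * m) = m by field_simp,
      Real.rpow_natCast]
    ring_nf
  rw [h2] at h1
  rw [radialFactor, radialFactor, normBesselI_eq_besselE (kernelArg_div_two_sq hr hρ),
    normBesselI_eq_besselE (kernelArg_div_two_sq hs hρ), kernelArg_div_two, kernelArg_div_two,
    map_mul, Complex.conj_ofReal, mul_mul_mul_comm, h1]
  push_cast
  ring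

/-- The weight `e ^ (-t ρ ^ a / a) ρ ^ (a - 2)`. -/
def heatWeight (a t ρ : ℝ) : ℝ := Real.exp (-(t / a * ρ ^ a)) * ρ ^ (a - 2)

theorem heatWeight_nonneg {ρ : ℝ} (hρ : 0 ≤ ρ) (a t : ℝ) : 0 ≤ heatWeight a t ρ := by
  unfold heatWeight; positivity

theorem measurable_heatWeight (a t : ℝ) : Measurable (heatWeight a t) := by
  unfold heatWeight; fun_prop

/-- Power count: for α = (2m+N-2)/a, both sides have exponent aα + a - 1 in ρ. -/
theorem pow_mul_rpow_eq {N : ℕ} (hN : 0 < N) {a ρ : ℝ} (ha : 0 < a) (hρ : 0 < ρ) (m : ℕ) :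
    ρ ^ (N - 1) * (ρ ^ 2) ^ m * ρ ^ (a - 2) =
      ρ ^ (a - 1) * (a ^ (2 / a * (m + ((N : ℝ) - 2) / 2)) *
        (ρ ^ a / a) ^ (2 / a * (m + ((N : ℝ) - 2) / 2))) := by
  rw [← Real.mul_rpow ha.le (by positivity), mul_div_cancel₀ _ ha.ne', ← Real.rpow_mul hρ.le,
    ← Real.rpow_add hρ, ← pow_mul, ← pow_add, ← Real.rpow_natCast, ← Real.rpow_add hρ]
  congr 1
  push_cast [Nat.cast_sub (show 1 ≤ N from hN)]
  field_simp
  ring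

theorem integral_radialFactor {N : ℕ} (hN : 0 < N) {a r s t : ℝ} (ha : 0 < a)
    (haν : -1 < 2 / a * (((N : ℝ) - 2) / 2)) (hr : 0 ≤ r) (hs : 0 ≤ s) (ht : 0 < t) (m : ℕ) :
    ∫ ρ in Set.Ioi (0 : ℝ), ((ρ ^ (N - 1) : ℝ) : ℂ) *
      (conj (radialFactor a (((N : ℝ) - 2) / 2) r m ρ) * radialFactor a (((N : ℝ) - 2) / 2) s m ρ *
        (heatWeight a t ρ : ℂ)) =
    (((r * s) ^ m * (1 / a) ^ (2 * (2 / a * m)) * a ^ (2 / a * (m + ((N : ℝ) - 2) / 2)) *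
      ((1 / t) ^ (2 / a * (m + ((N : ℝ) - 2) / 2) + 1) * (Real.exp (-((r ^ a / a + s ^ a / a) / t)) *
        besselE (2 / a * (m + ((N : ℝ) - 2) / 2)) (r ^ a / a * (s ^ a / a) / t ^ 2))) : ℝ) : ℂ) := by
  set ν : ℝ := ((N : ℝ) - 2) / 2 with hν
  set α : ℝ := 2 / a * (m + ν) with hα
  have hα1 : -1 < α := neg_one_lt_order ha haν m
  rw [← integral_besselE_mul_besselE hα1 (by positivity) (by positivity) ht,
    ← integral_rpow_mul_comp_rpow_div ha, ← integral_const_mul, ← integral_complex_ofReal]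
  refine setIntegral_congr_fun measurableSet_Ioi fun ρ hρ => ?_
  have hρ0 : (0 : ℝ) < ρ := hρ
  have h1 := pow_mul_rpow_eq hN ha hρ0 m
  rw [← hν, ← hα] at h1
  rw [conj_radialFactor_mul_radialFactor ha hr hs hρ0.le, ← Complex.ofReal_mul, ← Complex.ofReal_mul,
    ← hα]
  congr 1
  rw [heatWeight, mul_pow (r * s), show t * (ρ ^ a / a) = t / a * ρ ^ a by ring]
  linear_combination ((r * s) ^ m * (1 / a) ^ (2 * (2 / a * m)) *
        (besselE α (-(r ^ a / a * (ρ ^ a / a))) * besselE α (-(s ^ a / a * (ρ ^ a / a)))) *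
        Real.exp (-(t / a * ρ ^ a))) * h1

/-! ### Integrability against the heat weight, and the constant c_a -/

theorem abs_inner_normalized_le {E : Type*} [NormedAddCommGroup E] [InnerProductSpace ℝ E]
    {ω : E} (hω : ‖ω‖ = 1) (x : E) : |inner ℝ ω (‖x‖⁻¹ • x)| ≤ 1 := by
  refine (abs_real_inner_le_norm _ _).trans ?_
  rw [hω, one_mul, norm_smul, norm_inv, norm_norm]
  exact inv_mul_le_one

/-- Complete the square in ρ^(a/2), spending half of the exponent t/a. -/
theorem exp_rpow_half_mul_heatWeight_le {a t ρ : ℝ} (ha : 0 < a) (ht : 0 < t) (hρ : 0 ≤ ρ) (K : ℝ) :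
    Real.exp (K * ρ ^ (a / 2)) * heatWeight a t ρ ≤
      Real.exp (K ^ 2 * a / (2 * t)) * (ρ ^ (a - 2) * Real.exp (-(t / (2 * a)) * ρ ^ a)) := by
  have h : ρ ^ a = (ρ ^ (a / 2)) ^ 2 := by
    rw [← Real.rpow_natCast, ← Real.rpow_mul hρ]; norm_num
  rw [heatWeight, ← mul_assoc, ← Real.exp_add, mul_left_comm, ← Real.exp_add,
    mul_comm (ρ ^ (a - 2))]
  refine mul_le_mul_of_nonneg_right (Real.exp_le_exp.mpr ?_) (by positivity)
  rw [h]
  set u := ρ ^ (a / 2)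
  have h2 : K ^ 2 * a / (2 * t) + -(t / (2 * a)) * u ^ 2 - (K * u + -(t / a * u ^ 2)) =
      (K * a - t * u) ^ 2 / (2 * t * a) := by
    field_simp
    ring
  have h3 : 0 ≤ (K * a - t * u) ^ 2 / (2 * t * a) := by positivity
  linarith

variable {N : ℕ}

/-- Near 0 the radial density is ρ^(N+a-3), integrable precisely because a > 2 - N. -/
theorem integrable_exp_mul_heatWeight (hN : 0 < N) {a t : ℝ} (ha : 0 < a) (haN : 2 - (N : ℝ) < a)
    (ht : 0 < t) (K : ℝ) :
    Integrable (fun ξ : EuclideanSpace ℝ (Fin N) =>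
      Real.exp (K * ‖ξ‖ ^ (a / 2)) * heatWeight a t ‖ξ‖) := by
  have : NeZero N := ⟨hN.ne'⟩
  have h1 : Integrable (fun ξ : EuclideanSpace ℝ (Fin N) =>
      (fun ρ : ℝ => ρ ^ (a - 2) * Real.exp (-(t / (2 * a)) * ρ ^ a)) ‖ξ‖) := by
    refine (integrable_fun_norm_addHaar volume
      (f := fun ρ : ℝ => ρ ^ (a - 2) * Real.exp (-(t / (2 * a)) * ρ ^ a))).mpr ?_
    have h2 := integrableOn_rpow_mul_exp_neg_mul_rpow (p := a) (s := (N : ℝ) - 1 + (a - 2))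
      (b := t / (2 * a)) (by linarith) ha (by positivity)
    refine h2.congr_fun (fun ρ hρ => ?_) measurableSet_Ioi
    have hρ0 : (0 : ℝ) < ρ := hρ
    simp only [finrank_euclideanSpace, Fintype.card_fin, smul_eq_mul]
    rw [Real.rpow_add hρ0, ← Nat.cast_one, ← Nat.cast_sub hN, Real.rpow_natCast, mul_assoc]
  refine (h1.const_mul (Real.exp (K ^ 2 * a / (2 * t)))).mono' ?_
    (Filter.Eventually.of_forall fun ξ => ?_)
  · exact (Measurable.mul (by fun_prop)
      ((measurable_heatWeight a t).comp measurable_norm)).aestronglyMeasurable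
  · rw [Real.norm_of_nonneg (mul_nonneg (Real.exp_pos _).le (heatWeight_nonneg (norm_nonneg _) _ _))]
    exact exp_rpow_half_mul_heatWeight_le ha ht (norm_nonneg _) K

theorem constA_mul_eq_one (hN : 0 < N) {a : ℝ} (ha : 0 < a)
    (haν : -1 < 2 / a * (((N : ℝ) - 2) / 2)) :
    constA N a * ((volume : Measure (EuclideanSpace ℝ (Fin N))).toSphere.real Set.univ *
      (a ^ (2 / a * (((N : ℝ) - 2) / 2)) * Real.Gamma (2 / a * (((N : ℝ) - 2) / 2) + 1))) = 1 := by
  have : NeZero N := ⟨hN.ne'⟩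
  have h1 := integral_radial_mul_angular (E := EuclideanSpace ℝ (Fin N)) (𝕜 := ℝ)
    (fun ρ => heatWeight a 1 ρ) (fun _ => 1)
  have h2 : ∫ ρ in Set.Ioi (0 : ℝ), ρ ^ (N - 1) * heatWeight a 1 ρ =
      a ^ (2 / a * (((N : ℝ) - 2) / 2)) * Real.Gamma (2 / a * (((N : ℝ) - 2) / 2) + 1) := by
    have h3 := Real.integral_rpow_mul_exp_neg_mul_Ioi
      (show 0 < 2 / a * (((N : ℝ) - 2) / 2) + 1 by linarith) one_pos
    rw [one_div_one, Real.one_rpow, one_mul, add_sub_cancel_right] at h3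
    rw [← h3, ← integral_rpow_mul_comp_rpow_div ha
      (fun z => z ^ (2 / a * (((N : ℝ) - 2) / 2)) * Real.exp (-(1 * z))), ← integral_const_mul]
    refine setIntegral_congr_fun measurableSet_Ioi fun ρ hρ => ?_
    have h4 := pow_mul_rpow_eq hN ha (show 0 < ρ from hρ) 0
    rw [pow_zero, mul_one, Nat.cast_zero, zero_add] at h4
    simp only [heatWeight]
    rw [show 1 / a * ρ ^ a = 1 * (ρ ^ a / a) by ring]
    linear_combination (Real.exp (-(1 * (ρ ^ a / a)))) * h4
  have h5 : (∫ ρ in Set.Ioi (0 : ℝ), ((ρ ^ (Module.finrank ℝ (EuclideanSpace ℝ (Fin N)) - 1) : ℝ) : ℝ) *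
      heatWeight a 1 ρ) = ∫ ρ in Set.Ioi (0 : ℝ), ρ ^ (N - 1) * heatWeight a 1 ρ := by
    simp
  have hσ : (volume : Measure (EuclideanSpace ℝ (Fin N))).toSphere.real Set.univ ≠ 0 := by
    rw [Measure.real, ENNReal.toReal_ne_zero]
    exact ⟨Measure.measure_univ_ne_zero.mpr (Measure.toSphere_ne_zero _), measure_ne_top _ _⟩
  have hG : Real.Gamma (2 / a * (((N : ℝ) - 2) / 2) + 1) ≠ 0 :=
    (Real.Gamma_pos_of_pos (by linarith)).ne'
  have ha' : a ^ (2 / a * (((N : ℝ) - 2) / 2)) ≠ 0 := (Real.rpow_pos_of_pos ha _).ne'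
  rw [constA, ← h2, ← h5]
  rw [show (∫ x : EuclideanSpace ℝ (Fin N), Real.exp (-(‖x‖ ^ a / a)) * ‖x‖ ^ (a - 2)) =
    ∫ x : EuclideanSpace ℝ (Fin N), heatWeight a 1 ‖x‖ * 1 by
      congr 1; funext x; rw [heatWeight, mul_one]; ring_nf, h1]
  have h6 : ∫ _ : Metric.sphere (0 : EuclideanSpace ℝ (Fin N)) 1, (1 : ℝ)
      ∂(volume : Measure (EuclideanSpace ℝ (Fin N))).toSphere =
      (volume : Measure (EuclideanSpace ℝ (Fin N))).toSphere.real Set.univ := by simp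
  rw [h6]
  refine inv_mul_cancel₀ (mul_ne_zero hσ ?_)
  erw [h5, h2]
  exact mul_ne_zero ha' hG

/-! ### Termwise integration of the double series -/

/-- The `m`-th term of the series for the kernel `B_a(rω, ξ)`. -/
def kernelTerm (a r : ℝ) (ω : EuclideanSpace ℝ (Fin N)) (m : ℕ) (ξ : EuclideanSpace ℝ (Fin N)) : ℂ :=
  scriptITerm (2 / a) (((N : ℝ) - 2) / 2) (kernelArg a r ‖ξ‖) (inner ℝ ω (‖ξ‖⁻¹ • ξ)) m

theorem fourierKernel_eq_tsum_kernelTerm {a r : ℝ} (ha : 0 < a) (hr : 0 ≤ r)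
    {ω ξ : EuclideanSpace ℝ (Fin N)} (hω : ‖ω‖ = 1) (hξ : ξ ≠ 0) :
    fourierKernel a (r • ω) ξ =
      (Real.Gamma (2 / a * (((N : ℝ) - 2) / 2) + 1) : ℂ) * ∑' m, kernelTerm a r ω m ξ := by
  have hξ' := norm_ne_zero_iff.mpr hξ
  have h := fourierKernel_polar ha hr (norm_nonneg ξ) hω
    (show ‖‖ξ‖⁻¹ • ξ‖ = 1 by rw [norm_smul, norm_inv, norm_norm, inv_mul_cancel₀ hξ'])
  rw [smul_smul, mul_inv_cancel₀ hξ', one_smul] at h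
  rw [h]
  rfl

theorem measurable_kernelTerm (hN : 0 < N) {a : ℝ} (ha : 0 < a)
    (haν : -1 < 2 / a * (((N : ℝ) - 2) / 2)) (r : ℝ) (ω : EuclideanSpace ℝ (Fin N)) (m : ℕ) :
    Measurable (kernelTerm a r ω m) := by
  have hν : -1 < ((N : ℝ) - 2) / 2 := by
    have : (0 : ℝ) < N := Nat.cast_pos.mpr hN
    linarith
  have h1 : kernelTerm a r ω m = fun ξ => radialFactor a (((N : ℝ) - 2) / 2) r m ‖ξ‖ *
      (gegPoly (((N : ℝ) - 2) / 2) m (inner ℝ ω (‖ξ‖⁻¹ • ξ)) : ℂ) :=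
    funext fun ξ => scriptITerm_kernelArg hν _ _ _ _ _
  rw [h1]
  refine Measurable.mul ((measurable_radialFactor ha haν r m).comp measurable_norm) ?_
  exact Complex.measurable_ofReal.comp
    ((continuous_gegPoly _ m).measurable.comp (by fun_prop))

/-- The terms of the double series for the integrand of the heat kernel, without the constant. -/
def heatTerm (a r s t : ℝ) (ω μ : EuclideanSpace ℝ (Fin N)) (p : ℕ × ℕ)
    (ξ : EuclideanSpace ℝ (Fin N)) : ℂ :=
  conj (kernelTerm a r ω p.1 ξ) * kernelTerm a s μ p.2 ξ * (heatWeight a t ‖ξ‖ : ℂ)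

/-- Each term is a radial function times an angular one. Orthogonality removes p.1 ≠ p.2, where the
phases of the radial factors would not cancel. -/
theorem integral_heatTerm (hN : 0 < N) {a r s t : ℝ} (ha : 0 < a)
    (haν : -1 < 2 / a * (((N : ℝ) - 2) / 2)) (hr : 0 ≤ r) (hs : 0 ≤ s) (ht : 0 < t)
    {ω μ : EuclideanSpace ℝ (Fin N)} (hω : ‖ω‖ = 1) (hμ : ‖μ‖ = 1) (p : ℕ × ℕ) :
    ∫ ξ, heatTerm a r s t ω μ p ξ = if p.1 = p.2 then
      (((volume : Measure (EuclideanSpace ℝ (Fin N))).toSphere.real Set.univ *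
        gegPoly (((N : ℝ) - 2) / 2) p.2 (inner ℝ ω μ) *
      ((r * s) ^ p.2 * (1 / a) ^ (2 * (2 / a * p.2)) * a ^ (2 / a * (p.2 + ((N : ℝ) - 2) / 2)) *
      ((1 / t) ^ (2 / a * (p.2 + ((N : ℝ) - 2) / 2) + 1) *
        (Real.exp (-((r ^ a / a + s ^ a / a) / t)) *
        besselE (2 / a * (p.2 + ((N : ℝ) - 2) / 2)) (r ^ a / a * (s ^ a / a) / t ^ 2)))) : ℝ) : ℂ)
      else 0 := by
  have : NeZero N := ⟨hN.ne'⟩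
  obtain ⟨m, n⟩ := p
  have hν : -1 < ((N : ℝ) - 2) / 2 := by
    have : (0 : ℝ) < N := Nat.cast_pos.mpr hN
    linarith
  let f : ℝ → ℂ := fun ρ => conj (radialFactor a (((N : ℝ) - 2) / 2) r m ρ) *
    radialFactor a (((N : ℝ) - 2) / 2) s n ρ * (heatWeight a t ρ : ℂ)
  let g : EuclideanSpace ℝ (Fin N) → ℂ := fun η =>
    ((gegPoly (((N : ℝ) - 2) / 2) m (inner ℝ ω η) *
      gegPoly (((N : ℝ) - 2) / 2) n (inner ℝ μ η) : ℝ) : ℂ)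
  have h1 : ∀ ξ : EuclideanSpace ℝ (Fin N), heatTerm a r s t ω μ (m, n) ξ =
      f ‖ξ‖ * g (‖ξ‖⁻¹ • ξ) := fun ξ => by
    simp only [f, g]
    rw [heatTerm, kernelTerm, kernelTerm, scriptITerm_kernelArg hν, scriptITerm_kernelArg hν, map_mul,
      Complex.conj_ofReal]
    push_cast
    ring
  refine (integral_congr_ae (Filter.Eventually.of_forall h1)).trans
    ((integral_radial_mul_angular f g).trans ?_)
  have h2 : ∫ ξ : Metric.sphere (0 : EuclideanSpace ℝ (Fin N)) 1,
      ((gegPoly (((N : ℝ) - 2) / 2) m (inner ℝ ω (ξ : EuclideanSpace ℝ (Fin N))) *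
        gegPoly (((N : ℝ) - 2) / 2) n (inner ℝ μ (ξ : EuclideanSpace ℝ (Fin N))) : ℝ) : ℂ)
        ∂(volume : Measure (EuclideanSpace ℝ (Fin N))).toSphere =
      (((if m = n then (volume : Measure (EuclideanSpace ℝ (Fin N))).toSphere.real Set.univ *
        gegPoly (((N : ℝ) - 2) / 2) n (inner ℝ ω μ) else 0 : ℝ)) : ℂ) := by
    rw [integral_complex_ofReal, integral_gegPoly_mul_gegPoly (by simp; ring) hμ hω]
  erw [h2]
  simp only
  by_cases hmn : m = n
  · subst hmn
    rw [if_pos rfl, if_pos rfl, Complex.ofReal_mul (_ * _) (_ * _),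
      ← integral_radialFactor hN ha haν hr hs ht]
    simp [f]
  · rw [if_neg hmn, if_neg hmn, Complex.ofReal_zero, zero_mul]

/-- Here (w/2)² = RS/t² with R = r^a/a, S = s^a/a, the argument that Weber's integral produces. -/
theorem scriptITerm_of_real_arg {a r s t : ℝ} (ha : 0 < a) (hr : 0 ≤ r) (hs : 0 ≤ s) (ht : 0 < t)
    {ν : ℝ} (hν : -1 < ν) (τ : ℝ) (m : ℕ) :
    scriptITerm (2 / a) ν ((2 * (r * s) ^ (a / 2) / (a * t) : ℝ) : ℂ) τ m =
      (((r * s) ^ m * (1 / a) ^ (2 / a * m) * (1 / t) ^ (2 / a * m) *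
        besselE (2 / a * (m + ν)) (r ^ a / a * (s ^ a / a) / t ^ 2) * gegPoly ν m τ : ℝ) : ℂ) := by
  have h1 : (((2 * (r * s) ^ (a / 2) / (a * t) : ℝ) : ℂ) / 2) =
      (((r * s) ^ (a / 2) * (1 / a) * (1 / t) : ℝ) : ℂ) := by
    push_cast; field_simp
  have h2 : (((r * s) ^ (a / 2) * (1 / a) * (1 / t) : ℝ) : ℂ) ^ 2 =
      ((r ^ a / a * (s ^ a / a) / t ^ 2 : ℝ) : ℂ) := by
    rw [← Complex.ofReal_pow, mul_pow, mul_pow, ← Real.rpow_natCast ((r * s) ^ (a / 2)),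
      ← Real.rpow_mul (by positivity), show a / 2 * (2 : ℕ) = a by push_cast; ring,
      Real.mul_rpow hr hs]
    congr 1
    field_simp
  have h3 : ((r * s) ^ (a / 2) * (1 / a) * (1 / t)) ^ (2 / a * m) =
      (r * s) ^ m * (1 / a) ^ (2 / a * m) * (1 / t) ^ (2 / a * m) := by
    rw [Real.mul_rpow (by positivity) (by positivity), Real.mul_rpow (by positivity) (by positivity),
      ← Real.rpow_mul (by positivity), show a / 2 * (2 / a * m) = m by field_simp, Real.rpow_natCast]
  rw [scriptITerm, normGegenbauer_eq_gegPoly hν, normBesselI_eq_besselE (by rw [h1, h2]), h1,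
    ← Complex.ofReal_cpow (by positivity), h3]
  push_cast
  ring

/-- A summable majorant for the series of `𝓘(b, ν, w, t)`, uniform in `t ∈ [-1, 1]`. -/
def IsScriptIMajorant (b ν : ℝ) (c : ℕ → ℝ) (L : ℝ) : Prop :=
  (∀ m, 0 ≤ c m) ∧ Summable c ∧ 0 ≤ L ∧
    ∀ (w : ℂ) (t : ℝ) (m : ℕ), |t| ≤ 1 → ‖scriptITerm b ν w t m‖ ≤ c m * Real.exp (L * ‖w‖)

theorem norm_kernelTerm_le {a r L : ℝ} {c : ℕ → ℝ} (ha : 0 < a) (hr : 0 ≤ r)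
    (hc : IsScriptIMajorant (2 / a) (((N : ℝ) - 2) / 2) c L) {ω : EuclideanSpace ℝ (Fin N)}
    (hω : ‖ω‖ = 1) (m : ℕ) (ξ : EuclideanSpace ℝ (Fin N)) :
    ‖kernelTerm a r ω m ξ‖ ≤ c m * Real.exp (L * (2 * r ^ (a / 2) / a * ‖ξ‖ ^ (a / 2))) := by
  rw [← norm_kernelArg ha hr (norm_nonneg ξ)]
  exact hc.2.2.2 _ _ _ (abs_inner_normalized_le hω ξ)

theorem summable_norm_kernelTerm {a r L : ℝ} {c : ℕ → ℝ} (ha : 0 < a) (hr : 0 ≤ r)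
    (hc : IsScriptIMajorant (2 / a) (((N : ℝ) - 2) / 2) c L) {ω : EuclideanSpace ℝ (Fin N)}
    (hω : ‖ω‖ = 1) (ξ : EuclideanSpace ℝ (Fin N)) :
    Summable fun m => ‖kernelTerm a r ω m ξ‖ :=
  Summable.of_nonneg_of_le (fun _ => norm_nonneg _) (fun m => norm_kernelTerm_le ha hr hc hω m ξ)
    (hc.2.1.mul_right _)

theorem norm_tsum_kernelTerm_le {a r L : ℝ} {c : ℕ → ℝ} (ha : 0 < a) (hr : 0 ≤ r)
    (hc : IsScriptIMajorant (2 / a) (((N : ℝ) - 2) / 2) c L) {ω : EuclideanSpace ℝ (Fin N)}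
    (hω : ‖ω‖ = 1) (ξ : EuclideanSpace ℝ (Fin N)) :
    ‖∑' m, kernelTerm a r ω m ξ‖ ≤
      (∑' m, c m) * Real.exp (L * (2 * r ^ (a / 2) / a * ‖ξ‖ ^ (a / 2))) :=
  tsum_of_norm_bounded (hc.2.1.hasSum.mul_right _) fun m => norm_kernelTerm_le ha hr hc hω m ξ

theorem norm_conj_mul_mul_heatWeight_le {a t A B L κ₁ κ₂ ρ : ℝ} (hρ : 0 ≤ ρ) (hA : 0 ≤ A)
    {x y : ℂ} (hx : ‖x‖ ≤ A * Real.exp (L * (κ₁ * ρ ^ (a / 2))))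
    (hy : ‖y‖ ≤ B * Real.exp (L * (κ₂ * ρ ^ (a / 2)))) :
    ‖conj x * y * (heatWeight a t ρ : ℂ)‖ ≤
      A * B * (Real.exp (L * (κ₁ + κ₂) * ρ ^ (a / 2)) * heatWeight a t ρ) := by
  have hw := heatWeight_nonneg hρ a t
  rw [norm_mul, norm_mul, Complex.norm_conj, Complex.norm_real, Real.norm_of_nonneg hw]
  calc ‖x‖ * ‖y‖ * heatWeight a t ρ
      ≤ (A * Real.exp (L * (κ₁ * ρ ^ (a / 2)))) * (B * Real.exp (L * (κ₂ * ρ ^ (a / 2)))) *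
          heatWeight a t ρ := by gcongr
    _ = A * B * (Real.exp (L * (κ₁ * ρ ^ (a / 2))) * Real.exp (L * (κ₂ * ρ ^ (a / 2))) *
          heatWeight a t ρ) := by ring
    _ = _ := by rw [← Real.exp_add]; ring_nf

theorem tsum_heatTerm {a r s t L : ℝ} {c : ℕ → ℝ} (ha : 0 < a) (hr : 0 ≤ r) (hs : 0 ≤ s)
    (hc : IsScriptIMajorant (2 / a) (((N : ℝ) - 2) / 2) c L) {ω μ : EuclideanSpace ℝ (Fin N)}
    (hω : ‖ω‖ = 1) (hμ : ‖μ‖ = 1) (ξ : EuclideanSpace ℝ (Fin N)) :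
    ∑' p, heatTerm a r s t ω μ p ξ =
      conj (∑' m, kernelTerm a r ω m ξ) * (∑' m, kernelTerm a s μ m ξ) * (heatWeight a t ‖ξ‖ : ℂ) := by
  simp only [heatTerm]
  have h1 : Summable fun m => ‖conj (kernelTerm a r ω m ξ)‖ := by
    simp_rw [Complex.norm_conj]
    exact summable_norm_kernelTerm ha hr hc hω ξ
  rw [tsum_mul_right, Complex.conj_tsum,
    tsum_mul_tsum_of_summable_norm h1 (summable_norm_kernelTerm ha hs hc hμ ξ)]

/-- Only almost everywhere: at ξ = 0 the direction ‖ξ‖⁻¹ξ is not a unit vector. -/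
theorem heatIntegrand_ae_eq (hN : 0 < N) {a r s t L : ℝ} {c : ℕ → ℝ} (ha : 0 < a) (hr : 0 ≤ r)
    (hs : 0 ≤ s) (hc : IsScriptIMajorant (2 / a) (((N : ℝ) - 2) / 2) c L)
    {ω μ : EuclideanSpace ℝ (Fin N)} (hω : ‖ω‖ = 1) (hμ : ‖μ‖ = 1) :
    heatIntegrand a (r • ω) (s • μ) t =ᵐ[volume] fun ξ =>
      (Real.Gamma (2 / a * (((N : ℝ) - 2) / 2) + 1) : ℂ) ^ 2 * ∑' p, heatTerm a r s t ω μ p ξ := by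
  have : NeZero N := ⟨hN.ne'⟩
  filter_upwards [compl_mem_ae_iff.mpr (measure_singleton (0 : EuclideanSpace ℝ (Fin N)))] with ξ hξ
  rw [tsum_heatTerm ha hr hs hc hω hμ, heatIntegrand, fourierKernel_eq_tsum_kernelTerm ha hr hω hξ,
    fourierKernel_eq_tsum_kernelTerm ha hs hμ hξ, map_mul, Complex.conj_ofReal, heatWeight]
  ring

theorem integrable_tsum_heatTerm (hN : 0 < N) {a r s t L : ℝ} {c : ℕ → ℝ} (ha : 0 < a)
    (haN : 2 - (N : ℝ) < a) (haν : -1 < 2 / a * (((N : ℝ) - 2) / 2)) (hr : 0 ≤ r) (hs : 0 ≤ s)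
    (ht : 0 < t) (hc : IsScriptIMajorant (2 / a) (((N : ℝ) - 2) / 2) c L)
    {ω μ : EuclideanSpace ℝ (Fin N)} (hω : ‖ω‖ = 1) (hμ : ‖μ‖ = 1) :
    Integrable fun ξ => ∑' p, heatTerm a r s t ω μ p ξ := by
  simp_rw [tsum_heatTerm ha hr hs hc hω hμ]
  refine ((integrable_exp_mul_heatWeight hN ha haN ht
    (L * (2 * r ^ (a / 2) / a + 2 * s ^ (a / 2) / a))).const_mul ((∑' m, c m) * ∑' m, c m)).mono' ?_
    (Filter.Eventually.of_forall fun ξ => ?_)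
  · have h1 := measurable_tsum_of_summable (measurable_kernelTerm hN ha haν r ω)
      (fun ξ => (summable_norm_kernelTerm ha hr hc hω ξ).of_norm)
    have h2 := measurable_tsum_of_summable (measurable_kernelTerm hN ha haν s μ)
      (fun ξ => (summable_norm_kernelTerm ha hs hc hμ ξ).of_norm)
    exact (((Complex.continuous_conj.measurable.comp h1).mul h2).mul (Complex.measurable_ofReal.comp
      ((measurable_heatWeight a t).comp measurable_norm))).aestronglyMeasurable
  · exact norm_conj_mul_mul_heatWeight_le (norm_nonneg ξ) (tsum_nonneg hc.1)
      (norm_tsum_kernelTerm_le ha hr hc hω ξ) (norm_tsum_kernelTerm_le ha hs hc hμ ξ)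

/-- The terms are bounded by c_m c_n times one fixed integrable function. -/
theorem hasSum_integral_heatTerm (hN : 0 < N) {a r s t L : ℝ} {c : ℕ → ℝ} (ha : 0 < a)
    (haN : 2 - (N : ℝ) < a) (haν : -1 < 2 / a * (((N : ℝ) - 2) / 2)) (hr : 0 ≤ r) (hs : 0 ≤ s)
    (ht : 0 < t) (hc : IsScriptIMajorant (2 / a) (((N : ℝ) - 2) / 2) c L)
    {ω μ : EuclideanSpace ℝ (Fin N)} (hω : ‖ω‖ = 1) (hμ : ‖μ‖ = 1) :
    HasSum (fun p => ∫ ξ, heatTerm a r s t ω μ p ξ) (∫ ξ, ∑' p, heatTerm a r s t ω μ p ξ) := by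
  have hM := integrable_exp_mul_heatWeight hN ha haN ht
    (L * (2 * r ^ (a / 2) / a + 2 * s ^ (a / 2) / a))
  have hbound : ∀ p ξ, ‖heatTerm a r s t ω μ p ξ‖ ≤ c p.1 * c p.2 *
      (Real.exp (L * (2 * r ^ (a / 2) / a + 2 * s ^ (a / 2) / a) * ‖ξ‖ ^ (a / 2)) *
        heatWeight a t ‖ξ‖) := fun p ξ =>
    norm_conj_mul_mul_heatWeight_le (norm_nonneg ξ) (hc.1 _)
      (norm_kernelTerm_le ha hr hc hω p.1 ξ) (norm_kernelTerm_le ha hs hc hμ p.2 ξ)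
  have hint : ∀ p, Integrable (heatTerm a r s t ω μ p) := fun p => by
    refine (hM.const_mul (c p.1 * c p.2)).mono' ?_ (Filter.Eventually.of_forall (hbound p))
    exact (((Complex.continuous_conj.measurable.comp (measurable_kernelTerm hN ha haν r ω p.1)).mul
      (measurable_kernelTerm hN ha haν s μ p.2)).mul (Complex.measurable_ofReal.comp
      ((measurable_heatWeight a t).comp measurable_norm))).aestronglyMeasurable
  refine hasSum_integral_of_summable_integral_norm hint ?_
  refine Summable.of_nonneg_of_le (fun p => integral_nonneg fun ξ => norm_nonneg _) (fun p => ?_)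
    ((hc.2.1.mul_of_nonneg hc.2.1 hc.1 hc.1).mul_right (∫ ξ : EuclideanSpace ℝ (Fin N),
      Real.exp (L * (2 * r ^ (a / 2) / a + 2 * s ^ (a / 2) / a) * ‖ξ‖ ^ (a / 2)) *
        heatWeight a t ‖ξ‖))
  rw [← integral_const_mul]
  exact integral_mono (hint p).norm (hM.const_mul _) (hbound p)

/-! ### Comparison of coefficients and the expansion formula -/

theorem heat_coefficient_eq {a r s t C σ G ℓ g E : ℝ} (ha : 0 < a) (ht : 0 < t)
    (hC : C * (σ * (a ^ ℓ * G)) = 1) (β x : ℝ) (m : ℕ) :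
    C * (G ^ 2 * (σ * g * ((r * s) ^ m * (1 / a) ^ (2 * β) * a ^ (β + ℓ) *
      ((1 / t) ^ (β + ℓ + 1) * (x * E))))) =
    t ^ (-(ℓ + 1)) * x * (G * ((r * s) ^ m * (1 / a) ^ β * (1 / t) ^ β * E * g)) := by
  have h1 : (1 / a) ^ (2 * β) * a ^ (β + ℓ) = (1 / a) ^ β * a ^ ℓ := by
    rw [one_div, Real.inv_rpow ha.le, Real.inv_rpow ha.le, ← Real.rpow_neg ha.le,
      ← Real.rpow_neg ha.le, ← Real.rpow_add ha, ← Real.rpow_add ha]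
    ring_nf
  have h2 : (1 / t) ^ (β + ℓ + 1) = (1 / t) ^ β * t ^ (-(ℓ + 1)) := by
    rw [one_div, Real.inv_rpow ht.le, Real.inv_rpow ht.le, ← Real.rpow_neg ht.le,
      ← Real.rpow_neg ht.le, ← Real.rpow_add ht]
    ring_nf
  rw [mul_assoc ((r * s) ^ m), h1, h2]
  linear_combination (G * g * (r * s) ^ m * (1 / a) ^ β * (1 / t) ^ β * t ^ (-(ℓ + 1)) * x * E) * hC

theorem theorem4p4 (N : ℕ) (a : ℝ) (ha : max 0 (2 - (N : ℝ)) < a)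
    (r s t : ℝ) (hr : 0 ≤ r) (hs : 0 ≤ s) (ht : 0 < t)
    (ω μ : EuclideanSpace ℝ (Fin N))
    (hω : ω ∈ Metric.sphere (0 : EuclideanSpace ℝ (Fin N)) 1)
    (hμ : μ ∈ Metric.sphere (0 : EuclideanSpace ℝ (Fin N)) 1) :
    (∀ w : ℂ, Summable (scriptITerm (2 / a) (((N : ℝ) - 2) / 2) w (inner ℝ ω μ))) ∧
    MeasureTheory.Integrable (heatIntegrand a (r • ω) (s • μ) t) MeasureTheory.volume ∧
    heatKernel a (r • ω) (s • μ) t =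
      ((t ^ (-(lambdaA N a + 1)) * Real.exp (-((r ^ a + s ^ a) / (a * t))) : ℝ) : ℂ) *
        scriptI (2 / a) (((N : ℝ) - 2) / 2)
          ((2 * (r * s) ^ (a / 2) / (a * t) : ℝ) : ℂ) (inner ℝ ω μ) := by
  rw [mem_sphere_zero_iff_norm] at hω hμ
  -- In dimension 0 there is no unit vector.
  have hN : 0 < N := by
    rcases Nat.eq_zero_or_pos N with rfl | h
    · rw [Subsingleton.elim ω 0, norm_zero] at hω
      exact absurd hω zero_ne_one
    · exact h
  have haN : 2 - (N : ℝ) < a := (le_max_right _ _).trans_lt ha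
  replace ha : 0 < a := (le_max_left _ _).trans_lt ha
  have hlam : 2 / a * (((N : ℝ) - 2) / 2) = lambdaA N a := by rw [lambdaA]; field_simp
  have haν : -1 < 2 / a * (((N : ℝ) - 2) / 2) := by
    rw [hlam, lambdaA, lt_div_iff₀ ha]; linarith
  have hν : -1 < ((N : ℝ) - 2) / 2 := by
    have : (0 : ℝ) < N := Nat.cast_pos.mpr hN
    linarith
  have hb : 0 < 2 / a := by positivity
  obtain ⟨c, L, hc⟩ := exists_norm_scriptITerm_le hb hν haν
  change IsScriptIMajorant _ _ c L at hc
  refine ⟨fun w => ?_, ?_, ?_⟩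
  · refine Summable.of_norm_bounded (hc.2.1.mul_right _) fun m => hc.2.2.2 w _ m ?_
    simpa [hω, hμ] using abs_real_inner_le_norm ω μ
  · exact ((integrable_tsum_heatTerm hN ha haN haν hr hs ht hc hω hμ).const_mul _).congr
      (heatIntegrand_ae_eq hN ha hr hs hc hω hμ).symm
  · have h1 := hasSum_integral_heatTerm hN ha haN haν hr hs ht hc hω hμ
    have hinj : Function.Injective (fun m : ℕ => (m, m)) := fun m n h => congrArg Prod.fst h
    -- Off-diagonal integrals vanish, so the sum over pairs reduces to the diagonal (m, m).
    rw [← hinj.hasSum_iff (fun p hp => by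
      rw [integral_heatTerm hN ha haν hr hs ht hω hμ, if_neg]
      exact fun h => hp ⟨p.1, Prod.ext rfl h⟩)] at h1
    have h2 := h1.tsum_eq
    rw [heatKernel, integral_congr_ae (heatIntegrand_ae_eq hN ha hr hs hc hω hμ), integral_const_mul,
      ← h2, scriptI, ← tsum_mul_left, ← tsum_mul_left, ← tsum_mul_left, ← tsum_mul_left]
    congr 1
    funext m
    rw [Function.comp, integral_heatTerm hN ha haν hr hs ht hω hμ, if_pos rfl,
      scriptITerm_of_real_arg ha hr hs ht hν]
    have h3 := heat_coefficient_eq (r := r) (s := s) (g := gegPoly (((N : ℝ) - 2) / 2) m (inner ℝ ω μ))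
      (E := besselE (2 / a * (m + ((N : ℝ) - 2) / 2)) (r ^ a / a * (s ^ a / a) / t ^ 2)) ha ht
      (constA_mul_eq_one hN ha haν) (2 / a * m) (Real.exp (-((r ^ a + s ^ a) / (a * t)))) m
    rw [← mul_add (2 / a)] at h3
    rw [hlam] at h3 ⊢
    rw [show (r ^ a / a + s ^ a / a) / t = (r ^ a + s ^ a) / (a * t) by field_simp]
    exact_mod_cast h3

end
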